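/- Let $F=f+\psi$ on $\mathbb{R}^n$, where $f:\mathbb{R}^n\to\mathbb{R}$ is convex and differentiable and $\psi(x)=\sum_{i=1}^n\psi^i(x^i)$ with each $\psi^i:\mathbb{R}\to\mathbb{R}\cup\{+\infty\}$ proper, closed and convex. Let $v\in\mathbb{R}^n$ be a positive vector, $\|x\|_v^2=\sum_i v_i(x^i)^2$, let $x_*$ be a minimizer of $F$, and let $\mu_F(v)>0$ satisfy $F(x)\ge F(x_*)+\frac{\mu_F(v)}{2}\|x-x_*\|_v^2$ for all $x$. Let $\hat S$ be a random subset of $\{1,\dots,n\}$ with $\mathbf{P}(i\in\hat S)=\mathbf{P}(j\in\hat S)$ for all $i,j$ and $\tau=\mathbf{E}[|\hat S|]>0$, and assume $$\mathbf{E}[f(x+h_{[\hat S]})]\le f(x)+\frac{\tau}{n}\Big(\langle\nabla f(x),h\rangle+\frac12\|h\|_v^2\Big)\qquad\text{for all }x,h\in\mathbb{R}^n,$$ where $h_{[S]}=\sum_{i\in S}h^ie_i$. Let $S_0,S_1,\dots$ be independent copies of $\hat S$. Put $\theta_0=\tau/n$, $\theta_{k+1}=\frac12\big(\sqrt{\theta_k^4+4\theta_k^2}-\theta_k^2\big)$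 and $\frac1{\theta_{-1}^2}:=\frac{1-\theta_0}{\theta_0^2}$. Define $\gamma_0^0=1$, $\gamma_1^0=0$, $\gamma_1^1=1$ and, for $k\ge1$, $\gamma_{k+1}^i=(1-\theta_k)\gamma_k^i$ for $i\le k-1$, $\gamma_{k+1}^k=\theta_k(1-\frac n\tau\theta_{k-1})+\frac n\tau(\theta_{k-1}-\theta_k)$ and $\gamma_{k+1}^{k+1}=\frac n\tau\theta_k$. For $k\ge1$ let $$c_k=\frac1{\theta_0\theta_{k-1}}-\frac{1-\theta_0}{\theta_0^2},\qquad W_k=\sum_{i=0}^{k-1}\frac{\gamma_k^i}{\theta_{i-1}^2}+c_k,\qquad m_k(\mu)=\frac{\mu\theta_0^2}{1+\mu(1-\theta_0)}W_k .$$ An APPROX iteration from $(x_k,z_k)$ with parameter $\theta_k$ and set $S_k$ is: $y_k=(1-\theta_k)x_k+\theta_kz_k$; $z_{k+1}^i=\arg\min_{t\in\mathbb{R}}\{\nabla_if(y_k)(t-y_k^i)+\frac{\theta_knv_i}{2\tau}(t-z_k^i)^2+\psi^i(t)\}$ for $i\in S_k$ and $z_{k+1}^i=z_k^i$ for $i\notin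 S_k$; $x_{k+1}=y_k+\frac n\tau\theta_k(z_{k+1}-z_k)$. Restarted APPROX with parameters $K$ and $\sigma$ starts a cycle at an arbitrary $x_0\in\mathbb{R}^n$ (with $z_0=x_0$ and parameter $\theta_0$) and performs APPROX iterations $k=0,1,2,\dots$ with the sets $S_k$, the parameter running through $\theta_0,\theta_1,\dots$ within each cycle. At the end of each iteration $k$ with $k\equiv0\bmod K$, if the cycle then consists of the iterates $\tilde x_0,\dots,\tilde x_j$ (so that $\tilde x_j$ is the new iterate), the iterate $x_{k+1}$ is replaced by $$\bar x=\sigma\tilde x_j+(1-\sigma)\frac1{W_j}\Big(\sum_{i=0}^{j-1}\frac{\gamma_j^i}{\theta_{i-1}^2}\tilde x_i+c_j\tilde x_j\Big),$$ and a new cycle starts at $\bar x$. The statement is claimed both for this restart test and for the test $k+1\equiv0\bmod K$ (restarts exactly at the iterates $x_K,x_{2K},\dots$). Let $\Delta(x)=\frac{1-\theta_0}{\theta_0^2}(F(x)-F(x_*))+\frac1{2\theta_0^2}\|x-x_*\|_v^2\in[0,\infty]$ (with $0\cdot\infty=0$). (a) Let $\mu>0$ and $\lambda\ge\mu$, $K=\Big\lceil\frac{2\sqrt3}{\theta_0}\sqrt{\frac\lambda\mu}-\frac2{\theta_0}\Big\rceil$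 and $\sigma=\frac1{1+m_K(\mu)}$. Then the iterates of restarted APPROX satisfy, for all $k\ge K$, $$\mathbf{E}[\Delta(x_k)]\le\Big(1-\min\Big(\frac{\mu_F(v)}\mu,1\Big)\frac{\lambda-\mu(1-\theta_0)}{\lambda+1}\Big)^{\frac{k\theta_0\sqrt\mu}{2\sqrt3\sqrt\lambda}-1}\Delta(x_0).$$ (b) Let $\mu\in(0,1]$, $K=\Big\lceil\frac{2\sqrt3}{\theta_0}\sqrt{1+\frac1\mu}-\frac2{\theta_0}+1\Big\rceil$ and $\sigma=\frac1{1+m_K(\mu)}$. Then the iterates of restarted APPROX satisfy, for all $k\ge K$, $$\mathbf{E}[\Delta(x_k)]\le\Big(1-\min\Big(\frac{\mu_F(v)}\mu,1\Big)\frac{1+\mu\theta_0}{2+\mu}\Big)^{\frac{k\theta_0\sqrt\mu}{2\sqrt3\sqrt{1+\mu}}-1}\Delta(x_0).$$ -/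

import Mathlib

noncomputable section

namespace ApproxRestart

open MeasureTheory

/-! ### The composite problem -/

/-- Closed proper convex functions `ℝ → ℝ ∪ {+∞}`. -/
structure IsClosedProperConvex (g : ℝ → EReal) : Prop where
  ne_bot : ∀ t, g t ≠ ⊥
  proper : ∃ t, g t ≠ ⊤
  closed : LowerSemicontinuous g
  convex : ∀ s t a b : ℝ, 0 ≤ a → 0 ≤ b → a + b = 1 →
    g (a * s + b * t) ≤ (a : EReal) * g s + (b : EReal) * g t

/-- The objective `F(x) = f(x) + ∑ᵢ ψⁱ(xⁱ)`. -/
def objective {n : ℕ} (f : (Fin n → ℝ) → ℝ) (ψ : Fin n → ℝ → EReal) (x : Fin n → ℝ) : EReal :=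
  (f x : EReal) + ∑ i, ψ i (x i)

/-- The squared weighted norm `‖x‖ᵥ² = ∑ᵢ vᵢ (xⁱ)²`. -/
def wnormSq {n : ℕ} (v x : Fin n → ℝ) : ℝ := ∑ i, v i * x i ^ 2

/-! ### Samplings -/

/-- The expectation `E[g(Ŝ)]` for a random coordinate set `Ŝ` with law `p`. -/
def expect {n : ℕ} (p : PMF (Finset (Fin n))) (g : Finset (Fin n) → ℝ) : ℝ :=
  ∑ A, (p A).toReal * g A

/-- The average size `τ = E[|Ŝ|]`. -/
def tau {n : ℕ} (p : PMF (Finset (Fin n))) : ℝ := expect p fun A => (A.card : ℝ)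

/-- `θ₀ = τ / n`. -/
def theta0 {n : ℕ} (p : PMF (Finset (Fin n))) : ℝ := tau p / n

/-- All coordinates are sampled with the same probability: `P(i ∈ Ŝ) = P(j ∈ Ŝ)`. -/
def IsUniform {n : ℕ} (p : PMF (Finset (Fin n))) : Prop :=
  ∀ i j : Fin n, (expect p fun A => if i ∈ A then 1 else 0) =
    expect p fun A => if j ∈ A then 1 else 0

/-- `h_[A] = ∑_{i ∈ A} hⁱ eᵢ`. -/
def restrictTo {n : ℕ} (A : Finset (Fin n)) (h : Fin n → ℝ) : Fin n → ℝ :=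
  fun i => if i ∈ A then h i else 0

/-- Expected separable overapproximation, `(f, Ŝ) ∼ ESO(v)`:
`E[f(x + h_[Ŝ])] ≤ f(x) + (τ / n) (⟨∇f(x), h⟩ + ½ ‖h‖ᵥ²)` for all `x`, `h`. -/
def ESO {n : ℕ} (f : (Fin n → ℝ) → ℝ) (p : PMF (Finset (Fin n))) (v : Fin n → ℝ) : Prop :=
  ∀ x h : Fin n → ℝ, (expect p fun A => f (x + restrictTo A h)) ≤
    f x + tau p / n * (fderiv ℝ f x h + 1 / 2 * wnormSq v h)

/-! ### Coefficients -/

/-- `θ_{k+1} = (√(θₖ⁴ + 4 θₖ²) - θₖ²) / 2`, started at `θ₀`. -/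
def theta (θ₀ : ℝ) : ℕ → ℝ
  | 0 => θ₀
  | k + 1 => (Real.sqrt (theta θ₀ k ^ 4 + 4 * theta θ₀ k ^ 2) - theta θ₀ k ^ 2) / 2

/-- `1 / θ_{i-1}²`, where `1 / θ_{-1}² := (1 - θ₀) / θ₀²`. -/
def invThetaSqPred (θ₀ : ℝ) : ℕ → ℝ
  | 0 => (1 - θ₀) / θ₀ ^ 2
  | i + 1 => 1 / theta θ₀ i ^ 2

/-- The coefficients `γₖⁱ` (first argument `k`, then `i`; zero for `i > k`).
Here `n / τ` is written `1 / θ₀`. -/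
def gammaCoeff (θ₀ : ℝ) : ℕ → ℕ → ℝ
  | 0, i => if i = 0 then 1 else 0
  | 1, i => if i = 1 then 1 else 0
  | k + 2, i =>
    if i ≤ k then (1 - theta θ₀ (k + 1)) * gammaCoeff θ₀ (k + 1) i
    else if i = k + 1 then
      theta θ₀ (k + 1) * (1 - 1 / θ₀ * theta θ₀ k) +
        1 / θ₀ * (theta θ₀ k - theta θ₀ (k + 1))
    else if i = k + 2 then 1 / θ₀ * theta θ₀ (k + 1)
    else 0

/-- The weight `1 / (θ₀ θ_{k-1}) - (1 - θ₀) / θ₀²` of the last iterate, for `k ≥ 1`. -/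
def lastWeight (θ₀ : ℝ) (k : ℕ) : ℝ :=
  1 / (θ₀ * theta θ₀ (k - 1)) - (1 - θ₀) / θ₀ ^ 2

/-- `∑_{i<k} γₖⁱ / θ_{i-1}² + 1 / (θ₀ θ_{k-1}) - (1 - θ₀) / θ₀²`, for `k ≥ 1`. -/
def totalWeight (θ₀ : ℝ) (k : ℕ) : ℝ :=
  (∑ i ∈ Finset.range k, gammaCoeff θ₀ k i * invThetaSqPred θ₀ i) + lastWeight θ₀ k

/-- `mₖ(μ) = μ θ₀² / (1 + μ (1 - θ₀)) · totalWeight`, for `k ≥ 1`. -/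
def mCoeff (θ₀ : ℝ) (k : ℕ) (μ : ℝ) : ℝ :=
  μ * θ₀ ^ 2 / (1 + μ * (1 - θ₀)) * totalWeight θ₀ k

/-- The convex combination `x̊ₖ` of the iterates `x₀, …, xₖ` of a cycle. -/
def xRing {n : ℕ} (θ₀ : ℝ) (k : ℕ) (x : ℕ → Fin n → ℝ) : Fin n → ℝ :=
  (1 / totalWeight θ₀ k) •
    ((∑ i ∈ Finset.range k, (gammaCoeff θ₀ k i * invThetaSqPred θ₀ i) • x i) +
      lastWeight θ₀ k • x k)

/-- The restarting point `x̄ₖ = σ xₖ + (1 - σ) x̊ₖ`. -/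
def xBar {n : ℕ} (θ₀ σ : ℝ) (k : ℕ) (x : ℕ → Fin n → ℝ) : Fin n → ℝ :=
  σ • x k + (1 - σ) • xRing θ₀ k x

/-! ### The restarted algorithm -/

/-- A global minimiser of `g` (it is unique in every use below). -/
def argmin (g : ℝ → EReal) : ℝ := Classical.epsilon fun t => ∀ s, g t ≤ g s

/-- The memory of the algorithm: the number `age` of iterations since the last restart, the
iterates `hist 0, …, hist age` of the current cycle, and the current `z`. -/
structure State (n : ℕ) where
  age : ℕ
  hist : ℕ → Fin n → ℝ
  z : Fin n → ℝ

/-- The current iterate `xₖ`. -/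
def State.x {n : ℕ} (s : State n) : Fin n → ℝ := s.hist s.age

/-- The state at the beginning of a cycle at the point `x`: `xₖ = zₖ = x` and `θₖ = θ₀`. -/
def State.start {n : ℕ} (x : Fin n → ℝ) : State n := ⟨0, fun _ => x, x⟩

/-- `yₖ = (1 - θₖ) xₖ + θₖ zₖ`. -/
def yPoint {n : ℕ} (θ : ℝ) (x z : Fin n → ℝ) : Fin n → ℝ := (1 - θ) • x + θ • z

/-- The update of `z`: for `i ∈ A`,
`z_{k+1}ⁱ = argmin_t ∇ᵢf(y) (t - yⁱ) + (θ n vᵢ / (2 τ)) |t - zⁱ|² + ψⁱ(t)`;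
the other coordinates do not change. -/
def zUpdate {n : ℕ} (f : (Fin n → ℝ) → ℝ) (ψ : Fin n → ℝ → EReal) (v : Fin n → ℝ)
    (τ θ : ℝ) (y z : Fin n → ℝ) (A : Finset (Fin n)) : Fin n → ℝ := fun i =>
  if i ∈ A then
    argmin fun t =>
      ((fderiv ℝ f y (Pi.single i 1) * (t - y i) +
        θ * n * v i / (2 * τ) * (t - z i) ^ 2 : ℝ) : EReal) + ψ i t
  else z i

/-- One pass through the loop: an APPROX iteration with the coordinate set `A`, followed by a
restart at `x̄` of the current cycle if `restart` holds. -/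
def step {n : ℕ} (f : (Fin n → ℝ) → ℝ) (ψ : Fin n → ℝ → EReal) (v : Fin n → ℝ)
    (p : PMF (Finset (Fin n))) (σ : ℝ) (restart : Prop) [Decidable restart]
    (A : Finset (Fin n)) (s : State n) : State n :=
  let θ := theta (theta0 p) s.age
  let y := yPoint θ s.x s.z
  let z' := zUpdate f ψ v (tau p) θ y s.z A
  let x' := y + (n / tau p * θ) • (z' - s.z)
  let hist' := Function.update s.hist (s.age + 1) x'
  if restart then State.start (xBar (theta0 p) σ (s.age + 1) hist')
  else ⟨s.age + 1, hist', z'⟩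

/-- The state after `k` iterations along the sampled sets `S₀, S₁, …`. Iteration `k` ends with a
restart when `k + r ≡ 0 mod K`. -/
def run {n : ℕ} (f : (Fin n → ℝ) → ℝ) (ψ : Fin n → ℝ → EReal) (v : Fin n → ℝ)
    (p : PMF (Finset (Fin n))) (σ : ℝ) (K r : ℕ) (x₀ : Fin n → ℝ)
    (S : ℕ → Finset (Fin n)) : ℕ → State n
  | 0 => State.start x₀
  | k + 1 => step f ψ v p σ (K ∣ k + r) (S k) (run f ψ v p σ K r x₀ S k)

/-- `Δ(x) = ((1 - θ₀) / θ₀²) (F(x) - F(x*)) + (1 / (2 θ₀²)) ‖x - x*‖ᵥ²`, with values in `[0, ∞]`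
(used with `x*` a minimiser of `F`; `0 · ∞ = 0`). -/
def Delta {n : ℕ} (f : (Fin n → ℝ) → ℝ) (ψ : Fin n → ℝ → EReal) (v : Fin n → ℝ)
    (θ₀ : ℝ) (xs x : Fin n → ℝ) : ENNReal :=
  ENNReal.ofReal ((1 - θ₀) / θ₀ ^ 2) * (objective f ψ x - objective f ψ xs).toENNReal +
    ENNReal.ofReal (1 / (2 * θ₀ ^ 2) * wnormSq v (x - xs))

/-- The expectation `E[Δ(xₖ)]`, where `xₖ` is the `k`-th iterate of the restarted algorithm driven
by the random sets `S₀, S₁, …`. -/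
def expectedDelta {n : ℕ} {Ω : Type*} [MeasurableSpace Ω] (P : Measure Ω)
    (f : (Fin n → ℝ) → ℝ) (ψ : Fin n → ℝ → EReal) (v : Fin n → ℝ)
    (p : PMF (Finset (Fin n))) (S : ℕ → Ω → Finset (Fin n)) (xs : Fin n → ℝ)
    (σ : ℝ) (K r : ℕ) (x₀ : Fin n → ℝ) (k : ℕ) : ENNReal :=
  ∫⁻ ω, Delta f ψ v (theta0 p) xs (run f ψ v p σ K r x₀ (fun j => S j ω) k).x ∂P

end ApproxRestart

end

noncomputable section

namespace ApproxRestart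

open MeasureTheory

/-! ### The parameters `θₖ` -/

section Theta

variable {θ₀ : ℝ}

/-! Inside a cycle, each iterate is a convex combination of the prox points, `x_j = ∑ γ_j^i z_i`.
Replace `ψ(x_i)` by its convex majorant `∑ γ_i^l ψ(z_l)`, which evolves linearly under expectation.
The resulting Lyapunov value `L_i = (1/θ_{i-1}²)(f(x_i) + ∑ γ_i^l ψ(z_l) - F*) + ‖z_i - x*‖²/(2θ₀²)`
does not increase in mean (`expect_step_le`, from the ESO, the prox inequality and convexity of
`f`), and `L_0 = Δ(x_0)`.

Now average the `L_i` with the weights `γ_j^i`. Convexity of the norm moves the distances from the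
`z_i` to `x_j`. The weight of the gap at `x_j` exceeds its share in `Δ(x_j)` by exactly `c_j`. So
`Δ(x_j)` plus `W_j` times the gap at the averaged point `x̊` has mean at most `Δ(x_0)`.

Growth of `F` turns that gap into `m_j(μ_F) Δ(x̊)`. With `σ = 1/(1+m)`, convexity gives `Δ(x̄) ≤
σ(Δ(x_j) + m Δ(x̊))`. If `μ` overestimates `μ_F`, only the fraction `ρ = min(μ_F/μ, 1)` of `m` is
paid for by growth; the rest is bounded by `E Δ(x̊) ≤ Δ(x_0)`. A cycle therefore contracts by `1 - ρ
m/(1+m)` (`runExpect_restart_le`).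

The bound `∑ γ_K^i/θ_{i-1}² ≥ (K + 2/θ₀)²/12` makes `m` large when `K` is large, while an upper
bound on `K` makes restarts frequent (`expectedDelta_le`). Part (b) is the case `λ = 1 + μ`.

A start outside the domain has `Δ = ∞` unless `θ₀ = 1`; then all coordinates are almost surely
updated and the first step enters the domain. -/

lemma theta_pos (h0 : 0 < θ₀) : ∀ k, 0 < theta θ₀ k
  | 0 => h0
  | k + 1 => by
    have h := theta_pos h0 k
    have : theta θ₀ k ^ 2 < Real.sqrt (theta θ₀ k ^ 4 + 4 * theta θ₀ k ^ 2) := by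
      apply Real.lt_sqrt_of_sq_lt
      nlinarith [pow_pos h 2]
    simp only [theta]
    linarith

/-- The recursion selects the nonnegative root of `t² + θₖ² t - θₖ² = 0`; all later facts on `θ` use
this quadratic form. -/
lemma theta_succ_sq (k : ℕ) :
    theta θ₀ (k + 1) ^ 2 = (1 - theta θ₀ (k + 1)) * theta θ₀ k ^ 2 := by
  have := Real.sq_sqrt (show 0 ≤ theta θ₀ k ^ 4 + 4 * theta θ₀ k ^ 2 by positivity)
  simp only [theta]
  nlinarith

lemma theta_succ_lt_one (h0 : 0 < θ₀) (k : ℕ) : theta θ₀ (k + 1) < 1 := by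
  have h1 := theta_pos h0 k
  have h2 := theta_pos h0 (k + 1)
  have h3 := theta_succ_sq (θ₀ := θ₀) k
  by_contra! h
  nlinarith [pow_pos h1 2, pow_pos h2 2]

lemma theta_succ_le (h0 : 0 < θ₀) (k : ℕ) : theta θ₀ (k + 1) ≤ theta θ₀ k := by
  have h1 := theta_pos h0 k
  have h2 := theta_pos h0 (k + 1)
  have h3 := theta_succ_sq (θ₀ := θ₀) k
  refine (abs_le_of_sq_le_sq' ?_ h1.le).2
  nlinarith [pow_pos h1 2]

lemma theta_le (h0 : 0 < θ₀) : ∀ k, theta θ₀ k ≤ θ₀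
  | 0 => le_rfl
  | k + 1 => (theta_succ_le h0 k).trans (theta_le h0 k)

lemma one_div_theta_succ_sq (h0 : 0 < θ₀) (k : ℕ) :
    (1 - theta θ₀ (k + 1)) / theta θ₀ (k + 1) ^ 2 = 1 / theta θ₀ k ^ 2 := by
  have h1 := theta_pos h0 k
  have h2 := theta_pos h0 (k + 1)
  rw [div_eq_div_iff (by positivity) (by positivity), theta_succ_sq k]
  ring

/-- `(1 - θₖ) / θₖ² = 1 / θ_{k-1}²`, also for `k = 0`. -/
lemma one_sub_theta_div_sq (h0 : 0 < θ₀) :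
    ∀ k, (1 - theta θ₀ k) / theta θ₀ k ^ 2 = invThetaSqPred θ₀ k
  | 0 => rfl
  | k + 1 => one_div_theta_succ_sq h0 k

lemma invThetaSqPred_nonneg (h0 : 0 < θ₀) (h1 : θ₀ ≤ 1) : ∀ k, 0 ≤ invThetaSqPred θ₀ k
  | 0 => div_nonneg (by linarith) (by positivity)
  | k + 1 => by have := theta_pos h0 k; simp only [invThetaSqPred]; positivity

/-- With `u = 1/θ`, the quadratic relation reads `u_{k+1}² - u_{k+1} = u_k²`, so `(u_{k+1} - 1/2)² ≥
u_k²` and `u` grows by at least `1/2` per step. -/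
lemma half_le_one_div_theta (h0 : 0 < θ₀) (k : ℕ) :
    (k + 2 / θ₀) / 2 ≤ 1 / theta θ₀ k := by
  induction k with
  | zero => simp [theta]; field_simp; rfl
  | succ k ih =>
    have h1 := theta_pos h0 k
    have h2 := theta_pos h0 (k + 1)
    have e : (1 / theta θ₀ (k + 1)) ^ 2 - 1 / theta θ₀ (k + 1) = (1 / theta θ₀ k) ^ 2 := by
      rw [one_div_pow, one_div_pow, ← one_div_theta_succ_sq h0 k]
      field_simp
    have p1 : 0 < 1 / theta θ₀ k := by positivity
    have p2 : 0 < 1 / theta θ₀ (k + 1) := by positivity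
    have : 1 / theta θ₀ k + 1 / 2 ≤ 1 / theta θ₀ (k + 1) := by
      by_contra! h
      have p3 : 1 / 2 < 1 / theta θ₀ (k + 1) := by
        rw [div_lt_div_iff₀ two_pos h2]
        linarith [theta_succ_lt_one h0 k]
      nlinarith
    push_cast
    linarith

end Theta

/-! ### The coefficients `γₖⁱ` -/

section Gamma

variable {θ₀ : ℝ}

/-- The combination `∑_{i ≤ k} γₖⁱ aᵢ`. -/
def gammaSum {E : Type*} [AddCommGroup E] [Module ℝ E] (θ₀ : ℝ) (k : ℕ) (a : ℕ → E) : E :=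
  ∑ i ∈ Finset.range (k + 1), gammaCoeff θ₀ k i • a i

lemma gammaCoeff_succ_self (h0 : 0 < θ₀) (k : ℕ) :
    gammaCoeff θ₀ (k + 1) (k + 1) = theta θ₀ k / θ₀ := by
  cases k with
  | zero => simp [gammaCoeff, theta, h0.ne']
  | succ k => simp [gammaCoeff]; ring

/-- The starting point drops out of every later combination, so it need not lie in the domain. -/
lemma gammaCoeff_succ_zero : ∀ k, gammaCoeff θ₀ (k + 1) 0 = 0
  | 0 => by simp [gammaCoeff]
  | k + 1 => by simp [gammaCoeff, gammaCoeff_succ_zero k]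

lemma gammaCoeff_succ_prev (h0 : 0 < θ₀) (k : ℕ) : gammaCoeff θ₀ (k + 1) k =
    (1 - theta θ₀ k) * gammaCoeff θ₀ k k + theta θ₀ k - theta θ₀ k / θ₀ := by
  cases k with
  | zero => simp [gammaCoeff, theta, h0.ne']
  | succ k => rw [gammaCoeff_succ_self h0]; simp [gammaCoeff]; ring

/-- This is the recursion of the iterates `x_k` in terms of the `z_k`, which is why `x_k = gammaSum
θ₀ k z`. A general module `E` allows vectors, real values and functions of the state. -/
lemma gammaSum_succ {E : Type*} [AddCommGroup E] [Module ℝ E] (h0 : 0 < θ₀) (k : ℕ)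
    (a : ℕ → E) : gammaSum θ₀ (k + 1) a =
      (1 - theta θ₀ k) • gammaSum θ₀ k a + theta θ₀ k • a k +
        (theta θ₀ k / θ₀) • (a (k + 1) - a k) := by
  have hlow : ∀ i ∈ Finset.range k,
      gammaCoeff θ₀ (k + 1) i • a i = (1 - theta θ₀ k) • gammaCoeff θ₀ k i • a i := by
    intro i hi
    rw [Finset.mem_range] at hi
    obtain ⟨k, rfl⟩ : ∃ m, k = m + 1 := ⟨k - 1, by omega⟩
    rw [smul_smul]
    congr 1
    conv_lhs => rw [gammaCoeff]
    rw [if_pos (by omega)]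
  simp only [gammaSum]
  rw [Finset.sum_range_succ, Finset.sum_range_succ, Finset.sum_range_succ _ k,
    gammaCoeff_succ_self h0, gammaCoeff_succ_prev h0, Finset.sum_congr rfl hlow,
    ← Finset.smul_sum]
  module

@[simp] lemma gammaSum_zero {E : Type*} [AddCommGroup E] [Module ℝ E] (a : ℕ → E) :
    gammaSum θ₀ 0 a = a 0 := by
  simp [gammaSum, gammaCoeff]

/-- Only the index `i = k - 1` in row `k ≥ 2` is delicate: its sign reduces to `(1 - θ₀) θ_{k-2} ≤
θ_{k-1}`. -/
lemma gammaCoeff_nonneg (h0 : 0 < θ₀) :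
    ∀ k i, i ≤ k → 0 ≤ gammaCoeff θ₀ k i := by
  intro k
  induction k with
  | zero => intro i hi; obtain rfl : i = 0 := by omega
            simp [gammaCoeff]
  | succ k ih =>
    intro i hi
    have hk := theta_pos h0 k
    rcases lt_trichotomy i k with h | rfl | h
    · obtain ⟨k, rfl⟩ : ∃ m, k = m + 1 := ⟨k - 1, by omega⟩
      rw [gammaCoeff, if_pos (by omega)]
      exact mul_nonneg (by linarith [theta_succ_lt_one h0 k]) (ih i (by omega))
    · cases i with
      | zero => simp [gammaCoeff]
      | succ j =>
        have hj := theta_pos h0 j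
        have hsq := theta_succ_sq (θ₀ := θ₀) j
        have hlt := theta_succ_lt_one h0 j
        have hle := theta_le h0 (j + 1)
        rw [gammaCoeff_succ_prev h0, gammaCoeff_succ_self h0]
        have key : (1 - θ₀) * theta θ₀ j ≤ theta θ₀ (j + 1) := by
          refine (mul_le_mul_of_nonneg_right (by linarith :
            1 - θ₀ ≤ 1 - theta θ₀ (j + 1)) hj.le).trans ?_
          refine (abs_le_of_sq_le_sq' ?_ hk.le).2
          rw [hsq, mul_pow]
          have : 0 ≤ 1 - theta θ₀ (j + 1) := by linarith
          gcongr
          nlinarith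
        have e : (1 - theta θ₀ (j + 1)) * (theta θ₀ j / θ₀) + theta θ₀ (j + 1) -
            theta θ₀ (j + 1) / θ₀ =
            ((1 - theta θ₀ (j + 1)) * theta θ₀ j ^ 2 -
              theta θ₀ (j + 1) * ((1 - θ₀) * theta θ₀ j)) / (θ₀ * theta θ₀ j) := by
          field_simp
          ring
        rw [e, ← hsq]
        apply div_nonneg _ (by positivity)
        nlinarith
    · obtain rfl : i = k + 1 := by omega
      rw [gammaCoeff_succ_self h0]
      positivity

lemma sum_gammaCoeff (h0 : 0 < θ₀) (k : ℕ) :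
    ∑ i ∈ Finset.range (k + 1), gammaCoeff θ₀ k i = 1 := by
  have : gammaSum θ₀ k (fun _ => (1 : ℝ)) = 1 := by
    induction k with
    | zero => simp
    | succ k ih => rw [gammaSum_succ h0, ih]; simp
  simpa [gammaSum] using this

lemma lastWeight_pos (h0 : 0 < θ₀) (k : ℕ) : 0 < lastWeight θ₀ k := by
  have hk := theta_pos h0 (k - 1)
  rw [lastWeight, sub_pos, div_lt_div_iff₀ (by positivity) (by positivity)]
  have := theta_le h0 (k - 1)
  nlinarith [mul_pos h0 hk, mul_pos h0 h0, mul_pos (mul_pos h0 h0) hk]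

lemma gamma_mul_inv_nonneg (h0 : 0 < θ₀) (h1 : θ₀ ≤ 1) {k i : ℕ} (hi : i ≤ k) :
    0 ≤ gammaCoeff θ₀ k i * invThetaSqPred θ₀ i :=
  mul_nonneg (gammaCoeff_nonneg h0 k i hi) (invThetaSqPred_nonneg h0 h1 i)

lemma totalWeight_pos (h0 : 0 < θ₀) (h1 : θ₀ ≤ 1) (k : ℕ) : 0 < totalWeight θ₀ k :=
  add_pos_of_nonneg_of_pos (Finset.sum_nonneg fun _ hi =>
    gamma_mul_inv_nonneg h0 h1 (Finset.mem_range.1 hi).le) (lastWeight_pos h0 k)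

/-- The weight of the last iterate, split off from its share `(1 - θ₀) / θ₀²` in `Δ`. -/
lemma gamma_mul_inv_self (h0 : 0 < θ₀) {k : ℕ} (hk : 1 ≤ k) :
    gammaCoeff θ₀ k k * invThetaSqPred θ₀ k = lastWeight θ₀ k + (1 - θ₀) / θ₀ ^ 2 := by
  obtain ⟨k, rfl⟩ : ∃ m, k = m + 1 := ⟨k - 1, by omega⟩
  have := theta_pos h0 k
  rw [gammaCoeff_succ_self h0, lastWeight, invThetaSqPred, Nat.add_sub_cancel]
  field_simp
  ring

lemma gammaSum_invThetaSqPred (h0 : 0 < θ₀) {k : ℕ} (hk : 1 ≤ k) :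
    gammaSum θ₀ k (invThetaSqPred θ₀) = totalWeight θ₀ k + (1 - θ₀) / θ₀ ^ 2 := by
  simp only [gammaSum, smul_eq_mul]
  rw [Finset.sum_range_succ, gamma_mul_inv_self h0 hk, totalWeight]
  ring

/-- The sum `G` satisfies `G_{j+1} = (1 - θ_j) G_j + 1/θ_j - 1 + 1/θ₀`. With `t = k + 2/θ₀ ≥ 3` and
`1/θ_k ≥ t/2`, the loss `θ_k t²/12` is at most `t/6`, and the gain `t/2` covers it together with the
increment `(2t + 1)/12`. -/
lemma sq_div_twelve_le_gammaSum (h0 : 0 < θ₀) (h1 : θ₀ ≤ 1) {k : ℕ} (hk : 1 ≤ k) :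
    (k + 2 / θ₀) ^ 2 / 12 ≤ gammaSum θ₀ k (invThetaSqPred θ₀) := by
  have hu : 1 ≤ 1 / θ₀ := by rw [le_div_iff₀ h0]; linarith
  have e2 : 2 / θ₀ = 2 * (1 / θ₀) := by ring
  have hrec : ∀ j, gammaSum θ₀ (j + 1) (invThetaSqPred θ₀) =
      (1 - theta θ₀ j) * gammaSum θ₀ j (invThetaSqPred θ₀) + 1 / theta θ₀ j - 1 + 1 / θ₀ := by
    intro j
    have hj := theta_pos h0 j
    rw [gammaSum_succ h0]
    simp only [smul_eq_mul]
    rw [← one_sub_theta_div_sq h0 j, invThetaSqPred]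
    field_simp
    ring
  induction k, hk using Nat.le_induction with
  | base =>
    rw [hrec 0, gammaSum_zero, e2]
    simp only [theta, invThetaSqPred]
    have : (1 - θ₀) * ((1 - θ₀) / θ₀ ^ 2) + 1 / θ₀ - 1 + 1 / θ₀ = (1 / θ₀) ^ 2 := by
      field_simp; ring
    rw [this]
    push_cast
    nlinarith
  | succ k hk ih =>
    rw [hrec k]
    have hj := theta_pos h0 k
    have hb := half_le_one_div_theta h0 k
    have hk' : (1 : ℝ) ≤ k := by exact_mod_cast hk
    set t : ℝ := k + 2 / θ₀ with ht
    have ht3 : 3 ≤ t := by linarith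
    have hθ : theta θ₀ k * t ≤ 2 := by
      rw [le_div_iff₀ hj] at hb; linarith
    have hθ1 : 0 ≤ 1 - theta θ₀ k := by linarith [theta_le h0 k]
    have := mul_le_mul_of_nonneg_left ih hθ1
    push_cast
    have e : (k : ℝ) + 1 + 2 / θ₀ = t + 1 := by rw [ht]; ring
    rw [e]
    nlinarith

end Gamma

/-! ### One-dimensional closed convex functions and the proximal step -/

namespace IsClosedProperConvex

variable {g : ℝ → EReal}

lemma coe_toReal (hg : IsClosedProperConvex g) {t : ℝ} (ht : g t ≠ ⊤) :
    ((g t).toReal : EReal) = g t :=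
  EReal.coe_toReal ht (hg.ne_bot t)

lemma le_coe_combo (hg : IsClosedProperConvex g) {s t a b : ℝ} (hs : g s ≠ ⊤) (ht : g t ≠ ⊤)
    (ha : 0 ≤ a) (hb : 0 ≤ b) (hab : a + b = 1) :
    g (a * s + b * t) ≤ ((a * (g s).toReal + b * (g t).toReal : ℝ) : EReal) := by
  have h := hg.convex s t a b ha hb hab
  rw [← hg.coe_toReal hs, ← hg.coe_toReal ht] at h
  exact_mod_cast h

lemma convexOn_toReal (hg : IsClosedProperConvex g) :
    ConvexOn ℝ {t | g t ≠ ⊤} fun t => (g t).toReal := by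
  have hdom : ∀ ⦃s⦄, g s ≠ ⊤ → ∀ ⦃t⦄, g t ≠ ⊤ → ∀ ⦃a b : ℝ⦄, 0 ≤ a → 0 ≤ b → a + b = 1 →
      g (a * s + b * t) ≠ ⊤ := fun s hs t ht a b ha hb hab =>
    ((hg.le_coe_combo hs ht ha hb hab).trans_lt (EReal.coe_lt_top _)).ne
  refine ⟨hdom, fun s hs t ht a b ha hb hab => ?_⟩
  have h := hg.le_coe_combo hs ht ha hb hab
  simp only [smul_eq_mul]
  rw [← hg.coe_toReal (hdom hs ht ha hb hab)] at h
  exact_mod_cast h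

/-- A closed proper convex function is minorised by a cone. -/
lemma exists_cone_le (hg : IsClosedProperConvex g) : ∃ t₀ c d : ℝ, g t₀ ≠ ⊤ ∧ 0 ≤ d ∧
    ∀ t, ((c - d * |t - t₀| : ℝ) : EReal) ≤ g t := by
  obtain ⟨t₀, ht₀⟩ := hg.proper
  set r := (g t₀).toReal with hr
  have hlt : ((r - 1 : ℝ) : EReal) < g t₀ := by
    rw [← hg.coe_toReal ht₀]
    exact_mod_cast sub_one_lt r
  obtain ⟨ε, hε, hball⟩ := Metric.eventually_nhds_iff.1 (hg.closed t₀ _ hlt)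
  set δ := ε / 2
  have hδ : 0 < δ := half_pos hε
  have hδε : δ < ε := half_lt_self hε
  refine ⟨t₀, r - 1, 1 / δ, ht₀, by positivity, fun t => ?_⟩
  by_cases htop : g t = ⊤
  · rw [htop]; exact le_top
  by_cases hnear : |t - t₀| ≤ δ
  · refine le_trans ?_ (hball (y := t) ?_).le
    · have : 0 ≤ 1 / δ * |t - t₀| := by positivity
      exact_mod_cast (by linarith : r - 1 - 1 / δ * |t - t₀| ≤ r - 1)
    · rw [Real.dist_eq]; linarith
  · push Not at hnear
    have hpos : 0 < |t - t₀| := hδ.trans hnear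
    set l := δ / |t - t₀| with hl
    have hl0 : 0 < l := by positivity
    have hl1 : l ≤ 1 := (div_le_one hpos).2 hnear.le
    have hcomb := hg.le_coe_combo ht₀ htop (by linarith : 0 ≤ 1 - l) hl0.le (by ring)
    have hin : ((r - 1 : ℝ) : EReal) < g ((1 - l) * t₀ + l * t) := by
      apply hball
      rw [Real.dist_eq, show (1 - l) * t₀ + l * t - t₀ = l * (t - t₀) by ring, abs_mul,
        abs_of_pos hl0, hl, div_mul_cancel₀ _ hpos.ne']
      exact hδε
    have h : r - 1 < (1 - l) * (g t₀).toReal + l * (g t).toReal := by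
      exact_mod_cast hin.trans_le hcomb
    rw [← hg.coe_toReal htop]
    rw [EReal.coe_le_coe_iff, ← hr] at *
    have e : 1 / δ * |t - t₀| = 1 / l := by rw [hl]; field_simp
    rw [e]
    have : r - (g t).toReal < 1 / l := by
      rw [lt_div_iff₀ hl0]; nlinarith
    linarith

variable {a b y z : ℝ}

/-- The quadratic term beats the minorising cone away from `t₀`, so a minimiser over a compact
interval is global. Existence is what gives the choice-defined `argmin` its meaning. -/
lemma exists_prox (hg : IsClosedProperConvex g) (hb : 0 < b) :
    ∃ t, ∀ s, ((a * (t - y) + b * (t - z) ^ 2 : ℝ) : EReal) + g t ≤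
      ((a * (s - y) + b * (s - z) ^ 2 : ℝ) : EReal) + g s := by
  obtain ⟨t₀, c, d, ht₀, hd, hcone⟩ := hg.exists_cone_le
  set q : ℝ → ℝ := fun t => a * (t - y) + b * (t - z) ^ 2 with hq
  have hlsc : LowerSemicontinuous fun t => (q t : EReal) + g t := by
    apply LowerSemicontinuous.add'
    · exact (continuous_coe_real_ereal.comp (by fun_prop : Continuous q)).lowerSemicontinuous
    · exact hg.closed
    · intro t
      exact EReal.continuousAt_add (Or.inl (EReal.coe_ne_top _)) (Or.inl (EReal.coe_ne_bot _))
  set r := (g t₀).toReal with hr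
  set e := t₀ - z with he
  -- The radius is chosen so that beyond it `b u²` absorbs the cone slope `d`, the linear term of
  -- the quadratic at `t₀` and the offset `r - c`; the summand `1` gives `|u| ≥ 1`.
  set M := 1 + (d + |2 * b * e + a| + |r - c|) / b with hM
  have hM1 : 1 ≤ M := by
    have : 0 ≤ (d + |2 * b * e + a| + |r - c|) / b := by positivity
    linarith
  obtain ⟨t, -, ht⟩ := (hlsc.lowerSemicontinuousOn (Set.Icc (t₀ - M) (t₀ + M))).exists_isMinOn
    ⟨t₀, by constructor <;> linarith⟩ isCompact_Icc
  have hmem : t₀ ∈ Set.Icc (t₀ - M) (t₀ + M) := by constructor <;> linarith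
  refine ⟨t, fun s => ?_⟩
  by_cases hs : s ∈ Set.Icc (t₀ - M) (t₀ + M)
  · exact ht hs
  have hfar : M ≤ |s - t₀| := by
    by_contra! h
    rw [abs_lt] at h
    exact hs ⟨by linarith, by linarith⟩
  have hreal : q t₀ + r ≤ q s + (c - d * |s - t₀|) := by
    set u := s - t₀ with hu
    have e1 : q s - q t₀ = b * u ^ 2 + (2 * b * e + a) * u := by
      simp only [hq, hu, he]; ring
    have h1 : (d + |2 * b * e + a| + |r - c|) * |u| ≤ b * u ^ 2 := by
      rw [← sq_abs u]
      have : d + |2 * b * e + a| + |r - c| ≤ b * |u| := by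
        have : (d + |2 * b * e + a| + |r - c|) / b ≤ |u| := by linarith
        rw [div_le_iff₀ hb] at this; linarith
      nlinarith [abs_nonneg u]
    have h2 : -(|2 * b * e + a| * |u|) ≤ (2 * b * e + a) * u := by
      rw [← abs_mul]; exact neg_abs_le _
    have h3 : |r - c| ≤ |r - c| * |u| := le_mul_of_one_le_right (abs_nonneg _) (by linarith)
    have h4 := le_abs_self (r - c)
    nlinarith
  calc (q t : EReal) + g t ≤ q t₀ + g t₀ := ht hmem
    _ = ((q t₀ + r : ℝ) : EReal) := by rw [← hg.coe_toReal ht₀]; push_cast; rfl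
    _ ≤ ((q s + (c - d * |s - t₀|) : ℝ) : EReal) := by exact_mod_cast hreal
    _ ≤ q s + g s := by
      rw [EReal.coe_add]; exact add_le_add le_rfl (hcone s)

lemma argmin_le (hg : IsClosedProperConvex g) (hb : 0 < b) (s : ℝ) :
    ((a * (argmin (fun t => ((a * (t - y) + b * (t - z) ^ 2 : ℝ) : EReal) + g t) - y) +
      b * (argmin (fun t => ((a * (t - y) + b * (t - z) ^ 2 : ℝ) : EReal) + g t) - z) ^ 2 : ℝ) :
        EReal) + g (argmin fun t => ((a * (t - y) + b * (t - z) ^ 2 : ℝ) : EReal) + g t) ≤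
      ((a * (s - y) + b * (s - z) ^ 2 : ℝ) : EReal) + g s :=
  Classical.epsilon_spec (hg.exists_prox hb) s

lemma argmin_ne_top (hg : IsClosedProperConvex g) (hb : 0 < b) :
    g (argmin fun t => ((a * (t - y) + b * (t - z) ^ 2 : ℝ) : EReal) + g t) ≠ ⊤ := by
  obtain ⟨s, hs⟩ := hg.proper
  intro h
  have := hg.argmin_le (a := a) (y := y) (z := z) hb s
  rw [h, EReal.coe_add_top, top_le_iff, ← hg.coe_toReal hs, ← EReal.coe_add] at this
  exact EReal.coe_ne_top _ this

/-- The three-point inequality of the proximal step. -/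
lemma prox_le (hg : IsClosedProperConvex g) (hb : 0 < b) {w : ℝ} (hw : g w ≠ ⊤) {t : ℝ}
    (ht : t = argmin fun t => ((a * (t - y) + b * (t - z) ^ 2 : ℝ) : EReal) + g t) :
    a * (t - y) + b * (t - z) ^ 2 + (g t).toReal + b * (w - t) ^ 2 ≤
      a * (w - y) + b * (w - z) ^ 2 + (g w).toReal := by
  have htop : g t ≠ ⊤ := by rw [ht]; exact hg.argmin_ne_top hb
  have hmin : ∀ s, g s ≠ ⊤ → a * (t - y) + b * (t - z) ^ 2 + (g t).toReal ≤
      a * (s - y) + b * (s - z) ^ 2 + (g s).toReal := by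
    intro s hs
    have := hg.argmin_le (a := a) (y := y) (z := z) hb s
    rw [← ht, ← hg.coe_toReal hs, ← hg.coe_toReal htop] at this
    exact_mod_cast this
  -- Compare `t` with `(1 - l) t + l w` and divide by `l`; the exact quadratic gain `b (w - t)²`
  -- appears as `l → 0`.
  have hl : ∀ l ∈ Set.Ioo (0 : ℝ) 1, a * (t - y) + b * (t - z) ^ 2 + (g t).toReal +
      b * (1 - l) * (w - t) ^ 2 ≤ a * (w - y) + b * (w - z) ^ 2 + (g w).toReal := by
    rintro l ⟨h0, h1⟩
    have hc := hg.convexOn_toReal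
    have hs := hc.1 htop hw (by linarith : 0 ≤ 1 - l) h0.le (by ring)
    have h2 := hc.2 htop hw (by linarith : 0 ≤ 1 - l) h0.le (by ring)
    have h3 := hmin _ hs
    simp only [smul_eq_mul] at h2 h3
    have : l * (a * (t - y) + b * (t - z) ^ 2 + (g t).toReal +
      b * (1 - l) * (w - t) ^ 2) ≤ l * (a * (w - y) + b * (w - z) ^ 2 + (g w).toReal) := by
      nlinarith
    exact le_of_mul_le_mul_left this h0
  have hlim : Filter.Tendsto (fun l : ℝ => a * (t - y) + b * (t - z) ^ 2 + (g t).toReal +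
      b * (1 - l) * (w - t) ^ 2) (nhdsWithin 0 (Set.Ioi 0))
      (nhds (a * (t - y) + b * (t - z) ^ 2 + (g t).toReal + b * (1 - 0) * (w - t) ^ 2)) :=
    (Continuous.tendsto (by fun_prop) 0).mono_left nhdsWithin_le_nhds
  have := le_of_tendsto hlim (Filter.eventually_of_mem (Ioo_mem_nhdsGT one_pos) hl)
  simpa using this

end IsClosedProperConvex

/-! ### Convexity in several variables -/

/-- The first-order lower bound for a differentiable convex function. -/
lemma add_fderiv_le {E : Type*} [NormedAddCommGroup E] [NormedSpace ℝ E] {f : E → ℝ}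
    (hfd : Differentiable ℝ f) (hfc : ConvexOn ℝ Set.univ f) (x y : E) :
    f y + fderiv ℝ f y (x - y) ≤ f x := by
  set φ : ℝ → ℝ := fun t => f (y + t • (x - y)) with hφ
  have hconv : ConvexOn ℝ Set.univ φ := by
    have e : φ = f ∘ (AffineMap.lineMap y x : ℝ →ᵃ[ℝ] E) := by
      ext t
      simp [hφ, AffineMap.lineMap_apply, add_comm]
    rw [e]
    exact hfc.comp_affineMap (AffineMap.lineMap y x : ℝ →ᵃ[ℝ] E)
  have hderiv : HasDerivAt φ (fderiv ℝ f y (x - y)) 0 := by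
    have h1 : HasDerivAt (fun t : ℝ => y + t • (x - y)) (x - y) 0 := by
      simpa using ((hasDerivAt_id (0 : ℝ)).smul_const (x - y)).const_add y
    have h2 : HasFDerivAt f (fderiv ℝ f y) (y + (0 : ℝ) • (x - y)) := by
      simpa using (hfd y).hasFDerivAt
    exact h2.comp_hasDerivAt 0 h1
  have := hconv.le_slope_of_hasDerivAt (Set.mem_univ 0) (Set.mem_univ 1) one_pos hderiv
  simp only [slope, hφ, sub_zero, inv_one, one_smul, zero_smul, add_zero, vsub_eq_sub,
    add_sub_cancel] at this
  linarith

/-- Jensen's inequality where the points of weight zero may lie outside the domain. -/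
lemma convexOn_sum_le {ι E : Type*} [AddCommGroup E] [Module ℝ E] {D : Set E} {φ : E → ℝ}
    (hφ : ConvexOn ℝ D φ) (s : Finset ι) (w : ι → ℝ) (x : ι → E) (hw : ∀ i ∈ s, 0 ≤ w i)
    (hsum : ∑ i ∈ s, w i = 1) (hx : ∀ i ∈ s, w i ≠ 0 → x i ∈ D) :
    φ (∑ i ∈ s, w i • x i) ≤ ∑ i ∈ s, w i * φ (x i) := by
  classical
  have e1 : ∑ i ∈ s with w i ≠ 0, w i • x i = ∑ i ∈ s, w i • x i :=
    Finset.sum_filter_of_ne fun i _ h h' => h (by simp [h'])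
  have e2 : ∑ i ∈ s with w i ≠ 0, w i * φ (x i) = ∑ i ∈ s, w i * φ (x i) :=
    Finset.sum_filter_of_ne fun i _ h h' => h (by simp [h'])
  have e3 : ∑ i ∈ s with w i ≠ 0, w i = 1 := by rw [Finset.sum_filter_ne_zero, hsum]
  rw [← e1, ← e2]
  exact hφ.map_sum_le (fun i hi => hw i (Finset.mem_filter.1 hi).1) e3
    fun i hi => hx i (Finset.mem_filter.1 hi).1 (Finset.mem_filter.1 hi).2

lemma convex_sum_mem_of_ne_zero {ι E : Type*} [AddCommGroup E] [Module ℝ E] {D : Set E}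
    (hD : Convex ℝ D) (s : Finset ι) (w : ι → ℝ) (x : ι → E) (hw : ∀ i ∈ s, 0 ≤ w i)
    (hsum : ∑ i ∈ s, w i = 1) (hx : ∀ i ∈ s, w i ≠ 0 → x i ∈ D) :
    ∑ i ∈ s, w i • x i ∈ D := by
  classical
  have e1 : ∑ i ∈ s with w i ≠ 0, w i • x i = ∑ i ∈ s, w i • x i :=
    Finset.sum_filter_of_ne fun i _ h h' => h (by simp [h'])
  have e3 : ∑ i ∈ s with w i ≠ 0, w i = 1 := by rw [Finset.sum_filter_ne_zero, hsum]
  rw [← e1]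
  exact hD.sum_mem (fun i hi => hw i (Finset.mem_filter.1 hi).1) e3
    fun i hi => hx i (Finset.mem_filter.1 hi).1 (Finset.mem_filter.1 hi).2

/-! ### Expectations over a sampling -/

section Sampling

variable {n : ℕ} {p : PMF (Finset (Fin n))}

lemma expect_add (g h : Finset (Fin n) → ℝ) :
    expect p (fun A => g A + h A) = expect p g + expect p h := by
  simp only [expect, mul_add, Finset.sum_add_distrib]

lemma expect_const_mul (c : ℝ) (g : Finset (Fin n) → ℝ) :
    expect p (fun A => c * g A) = c * expect p g := by
  simp only [expect, Finset.mul_sum]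
  exact Finset.sum_congr rfl fun _ _ => by ring

lemma sum_toReal_pmf : ∑ A, (p A).toReal = 1 := by
  rw [← ENNReal.toReal_sum fun A _ => p.apply_ne_top A, ← tsum_fintype (L := .unconditional _),
    p.tsum_coe, ENNReal.toReal_one]

@[simp] lemma expect_const (c : ℝ) : expect p (fun _ => c) = c := by
  rw [expect, ← Finset.sum_mul, sum_toReal_pmf, one_mul]

lemma expect_mono {g h : Finset (Fin n) → ℝ} (hgh : ∀ A, p A ≠ 0 → g A ≤ h A) :
    expect p g ≤ expect p h := by
  refine Finset.sum_le_sum fun A _ => ?_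
  by_cases hA : p A = 0
  · simp [hA]
  · exact mul_le_mul_of_nonneg_left (hgh A hA) ENNReal.toReal_nonneg

lemma expect_sum {ι : Type*} (s : Finset ι) (g : ι → Finset (Fin n) → ℝ) :
    expect p (fun A => ∑ i ∈ s, g i A) = ∑ i ∈ s, expect p (g i) := by
  simp only [expect, Finset.mul_sum]
  exact Finset.sum_comm

lemma expect_mem (hunif : IsUniform p) (i : Fin n) :
    (expect p fun A => if i ∈ A then 1 else 0) = theta0 p := by
  have hn : (n : ℝ) ≠ 0 := by
    have : 0 < n := i.pos
    positivity
  have h : tau p = ∑ j, expect p fun A => if j ∈ A then (1 : ℝ) else 0 := by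
    rw [← expect_sum]
    simp [tau]
  rw [theta0, eq_div_iff hn, h, Finset.sum_congr rfl fun j _ => hunif j i]
  simp [mul_comm]

/-- Separable functions see only the marginals of the sampling, all equal to `θ₀`; correlations
between coordinates do not matter. -/
lemma expect_sum_ite (hunif : IsUniform p) (a b : Fin n → ℝ) :
    expect p (fun A => ∑ i, if i ∈ A then a i else b i) =
      theta0 p * ∑ i, a i + (1 - theta0 p) * ∑ i, b i := by
  rw [expect_sum, Finset.mul_sum, Finset.mul_sum, ← Finset.sum_add_distrib]
  refine Finset.sum_congr rfl fun i _ => ?_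
  have e : (fun A : Finset (Fin n) => if i ∈ A then a i else b i) =
      fun A => (a i - b i) * (if i ∈ A then 1 else 0) + b i := by
    ext A; split_ifs <;> ring
  rw [e, expect_add, expect_const_mul, expect_const, expect_mem hunif]
  ring

lemma pos_of_tau_pos (hτ : 0 < tau p) : 0 < n := by
  rcases Nat.eq_zero_or_pos n with rfl | h
  · simp [tau, expect, Finset.eq_empty_of_isEmpty] at hτ
  · exact h

lemma theta0_pos (hτ : 0 < tau p) : 0 < theta0 p :=
  div_pos hτ (by exact_mod_cast pos_of_tau_pos hτ)

lemma tau_le : tau p ≤ n := by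
  rw [← expect_const (p := p) (n : ℝ)]
  exact expect_mono fun A _ => by simpa using A.card_le_univ

lemma theta0_le_one : theta0 p ≤ 1 :=
  div_le_one_of_le₀ tau_le (by positivity)

/-- The nonnegative variable `n - |A|` has mean zero. This handles starting points outside the
domain when `θ₀ = 1`. -/
lemma eq_univ_of_theta0_eq_one (hτ : 0 < tau p) (h1 : theta0 p = 1) {A : Finset (Fin n)}
    (hA : p A ≠ 0) : A = Finset.univ := by
  have hn : (n : ℝ) ≠ 0 := by exact_mod_cast (pos_of_tau_pos hτ).ne'
  have h : expect p (fun A => (n : ℝ) + (-1) * (A.card : ℝ)) = 0 := by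
    rw [expect_add, expect_const, expect_const_mul]
    rw [theta0, div_eq_one_iff_eq hn] at h1
    change (n : ℝ) + -1 * tau p = 0
    linarith
  have hle : ∀ B : Finset (Fin n), (B.card : ℝ) ≤ n := fun B => by
    simpa using B.card_le_univ
  have h2 := (Finset.sum_eq_zero_iff_of_nonneg fun B _ =>
    mul_nonneg ENNReal.toReal_nonneg (by linarith [hle B])).1 h A (Finset.mem_univ A)
  have h3 : (p A).toReal ≠ 0 := ENNReal.toReal_ne_zero.2 ⟨hA, p.apply_ne_top A⟩
  have h4 : (A.card : ℝ) = n := by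
    have := (mul_eq_zero.1 h2).resolve_left h3
    linarith
  rw [← Finset.card_eq_iff_eq_univ, Fintype.card_fin]
  exact_mod_cast h4

end Sampling

/-! ### The composite objective on its domain -/

/-- The standing hypotheses on the problem, the sampling and the minimiser. -/
structure IsProblem {n : ℕ} (f : (Fin n → ℝ) → ℝ) (ψ : Fin n → ℝ → EReal) (v : Fin n → ℝ)
    (p : PMF (Finset (Fin n))) (xs : Fin n → ℝ) : Prop where
  differentiable : Differentiable ℝ f
  convexOn : ConvexOn ℝ Set.univ f
  closed : ∀ i, IsClosedProperConvex (ψ i)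
  weight_pos : ∀ i, 0 < v i
  uniform : IsUniform p
  tau_pos : 0 < tau p
  eso : ESO f p v
  objective_le : ∀ x, objective f ψ xs ≤ objective f ψ x

/-- The domain of `∑ᵢ ψⁱ(xⁱ)`. -/
def dom {n : ℕ} (ψ : Fin n → ℝ → EReal) : Set (Fin n → ℝ) := {x | ∀ i, ψ i (x i) ≠ ⊤}

/-- The real value of `∑ᵢ ψⁱ(xⁱ)` on the domain. -/
def sepReal {n : ℕ} (ψ : Fin n → ℝ → EReal) (x : Fin n → ℝ) : ℝ := ∑ i, (ψ i (x i)).toReal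

/-- The real value of `F` on the domain. -/
def objReal {n : ℕ} (f : (Fin n → ℝ) → ℝ) (ψ : Fin n → ℝ → EReal) (x : Fin n → ℝ) : ℝ :=
  f x + sepReal ψ x

section Objective

variable {n : ℕ} {f : (Fin n → ℝ) → ℝ} {ψ : Fin n → ℝ → EReal} {v : Fin n → ℝ}
  {p : PMF (Finset (Fin n))} {xs : Fin n → ℝ}

lemma wnormSq_nonneg (hv : ∀ i, 0 < v i) (x : Fin n → ℝ) : 0 ≤ wnormSq v x :=
  Finset.sum_nonneg fun i _ => mul_nonneg (hv i).le (sq_nonneg _)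

lemma convexOn_wnormSq (hv : ∀ i, 0 < v i) (xs : Fin n → ℝ) :
    ConvexOn ℝ Set.univ fun x => wnormSq v (x - xs) := by
  refine ⟨convex_univ, fun x _ y _ a b ha hb hab => ?_⟩
  simp only [wnormSq, smul_eq_mul, Finset.mul_sum, ← Finset.sum_add_distrib]
  refine Finset.sum_le_sum fun i _ => ?_
  simp only [Pi.sub_apply, Pi.add_apply, Pi.smul_apply, smul_eq_mul]
  obtain rfl : b = 1 - a := by linarith
  have : 0 ≤ v i * (a * (1 - a) * (x i - y i) ^ 2) := by
    have := (hv i).le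
    positivity
  nlinarith

lemma convexOn_sepReal (hψ : ∀ i, IsClosedProperConvex (ψ i)) :
    ConvexOn ℝ (dom ψ) (sepReal ψ) := by
  constructor
  · intro x hx y hy a b ha hb hab i
    exact (hψ i).convexOn_toReal.1 (hx i) (hy i) ha hb hab
  · intro x hx y hy a b ha hb hab
    simp only [sepReal, smul_eq_mul, Finset.mul_sum, ← Finset.sum_add_distrib]
    exact Finset.sum_le_sum fun i _ => (hψ i).convexOn_toReal.2 (hx i) (hy i) ha hb hab

lemma objective_eq (hψ : ∀ i, IsClosedProperConvex (ψ i)) {x : Fin n → ℝ} (hx : x ∈ dom ψ) :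
    objective f ψ x = (objReal f ψ x : EReal) := by
  rw [objective, objReal, sepReal, EReal.coe_add]
  congr 1
  have hs : ∀ s : Finset (Fin n),
      ∑ i ∈ s, ψ i (x i) = ((∑ i ∈ s, (ψ i (x i)).toReal : ℝ) : EReal) := fun s => by
    induction s using Finset.cons_induction with
    | empty => simp
    | cons a s ha ih =>
      rw [Finset.sum_cons, Finset.sum_cons, EReal.coe_add, ih, (hψ a).coe_toReal (hx a)]
  exact hs _

lemma objective_eq_top (hψ : ∀ i, IsClosedProperConvex (ψ i)) {x : Fin n → ℝ}
    (hx : x ∉ dom ψ) : objective f ψ x = ⊤ := by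
  obtain ⟨i, hi⟩ : ∃ i, ψ i (x i) = ⊤ := by
    by_contra! hc
    exact hx hc
  have hb : ∀ s : Finset (Fin n), ∑ j ∈ s, ψ j (x j) ≠ ⊥ := fun s => by
    induction s using Finset.cons_induction with
    | empty => simp
    | cons a s ha ih =>
      rw [Finset.sum_cons]
      simp [EReal.add_eq_bot_iff, ih, (hψ a).ne_bot]
  rw [objective, ← Finset.add_sum_erase _ _ (Finset.mem_univ i), hi,
    EReal.top_add_of_ne_bot (hb _), EReal.coe_add_top]

namespace IsProblem

variable (h : IsProblem f ψ v p xs)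
include h

lemma theta0_pos : 0 < theta0 p := ApproxRestart.theta0_pos h.tau_pos

lemma min_mem_dom : xs ∈ dom ψ := by
  by_contra hxs
  choose x hx using fun i => (h.closed i).proper
  have := h.objective_le x
  rw [objective_eq_top h.closed hxs, top_le_iff, objective_eq h.closed hx] at this
  exact EReal.coe_ne_top _ this

lemma objReal_le {x : Fin n → ℝ} (hx : x ∈ dom ψ) : objReal f ψ xs ≤ objReal f ψ x := by
  have := h.objective_le x
  rw [objective_eq h.closed hx, objective_eq h.closed h.min_mem_dom] at this
  exact_mod_cast this

lemma convexOn_objReal : ConvexOn ℝ (dom ψ) (objReal f ψ) :=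
  (h.convexOn.subset (Set.subset_univ _) (convexOn_sepReal h.closed).1).add
    (convexOn_sepReal h.closed)

end IsProblem

end Objective

/-! ### The descent inequality of one iteration -/

section OneStep

variable {n : ℕ} {f : (Fin n → ℝ) → ℝ} {ψ : Fin n → ℝ → EReal} {v : Fin n → ℝ}
  {p : PMF (Finset (Fin n))} {xs : Fin n → ℝ}

/-- The coordinate subproblems do not depend on `A`, so the random update masks a deterministic full
update. -/
lemma zUpdate_eq (τ T : ℝ) (y z : Fin n → ℝ) (A : Finset (Fin n)) (i : Fin n) :
    zUpdate f ψ v τ T y z A i = if i ∈ A then zUpdate f ψ v τ T y z Finset.univ i else z i := by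
  simp [zUpdate]

lemma fderiv_eq_sum (y d : Fin n → ℝ) :
    fderiv ℝ f y d = ∑ i, fderiv ℝ f y (Pi.single i 1) * d i := by
  conv_lhs => rw [← Finset.univ_sum_single d]
  rw [map_sum]
  refine Finset.sum_congr rfl fun i _ => ?_
  have : Pi.single i (d i) = d i • (Pi.single i 1 : Fin n → ℝ) := by
    rw [← Pi.single_smul, smul_eq_mul, mul_one]
  rw [this, map_smul, smul_eq_mul, mul_comm]

namespace IsProblem

variable (h : IsProblem f ψ v p xs)
include h

lemma prox_weight_pos {T : ℝ} (hT : 0 < T) (i : Fin n) : 0 < T * n * v i / (2 * tau p) := by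
  have := h.weight_pos i
  have := h.tau_pos
  have : (0 : ℝ) < n := by exact_mod_cast pos_of_tau_pos h.tau_pos
  positivity

lemma zUpdate_mem_dom {T : ℝ} (hT : 0 < T) {y z : Fin n → ℝ} {A : Finset (Fin n)}
    (hz : z ∈ dom ψ ∨ theta0 p = 1) (hA : p A ≠ 0) :
    zUpdate f ψ v (tau p) T y z A ∈ dom ψ := by
  intro i
  simp only [zUpdate]
  split_ifs with hi
  · exact (h.closed i).argmin_ne_top (h.prox_weight_pos hT i)
  · rcases hz with hz | h1
    · exact hz i
    · rw [eq_univ_of_theta0_eq_one h.tau_pos h1 hA] at hi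
      exact absurd (Finset.mem_univ i) hi

/-- The three-point inequality for the full proximal update. -/
lemma full_prox_le {T : ℝ} (hT : 0 < T) (y z : Fin n → ℝ) :
    let w := zUpdate f ψ v (tau p) T y z Finset.univ
    fderiv ℝ f y (w - y) + T / (2 * theta0 p) * wnormSq v (w - z) + sepReal ψ w +
        T / (2 * theta0 p) * wnormSq v (w - xs) ≤
      fderiv ℝ f y (xs - y) + T / (2 * theta0 p) * wnormSq v (z - xs) + sepReal ψ xs := by
  intro w
  rw [fderiv_eq_sum y (w - y), fderiv_eq_sum y (xs - y)]
  simp only [wnormSq, sepReal, Finset.mul_sum, ← Finset.sum_add_distrib]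
  refine Finset.sum_le_sum fun i _ => ?_
  have hw : w i = argmin fun t => ((fderiv ℝ f y (Pi.single i 1) * (t - y i) +
      T * n * v i / (2 * tau p) * (t - z i) ^ 2 : ℝ) : EReal) + ψ i t := by
    simp [w, zUpdate]
  have := (h.closed i).prox_le (h.prox_weight_pos hT i) (h.min_mem_dom i) hw
  have e : T * n * v i / (2 * tau p) = T / (2 * theta0 p) * v i := by
    rw [theta0]
    have := h.tau_pos.ne'
    have : (n : ℝ) ≠ 0 := by exact_mod_cast (pos_of_tau_pos h.tau_pos).ne'
    field_simp
  rw [e] at this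
  simp only [Pi.sub_apply]
  linarith

/-- The expected decrease in one iteration; `Φ` stands for the weighted average of the values
`ψ(z₀), …, ψ(zₖ)`. -/
lemma expect_step_le {T : ℝ} (hT : 0 < T) (hT1 : T ≤ 1) (x z : Fin n → ℝ) (Φ : ℝ) :
    let y := yPoint T x z
    let w := zUpdate f ψ v (tau p) T y z
    expect p (fun A => f (y + (n / tau p * T) • (w A - z)) +
        ((1 - T) * Φ + T * sepReal ψ z + T / theta0 p * (sepReal ψ (w A) - sepReal ψ z)) -
          objReal f ψ xs + T ^ 2 / (2 * theta0 p ^ 2) * wnormSq v (w A - xs)) ≤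
      (1 - T) * (f x + Φ - objReal f ψ xs) + T ^ 2 / (2 * theta0 p ^ 2) * wnormSq v (z - xs) := by
  intro y w
  have h0 := h.theta0_pos
  set θ := theta0 p with hθ
  set u := w Finset.univ with hu
  have hθinv : (n : ℝ) / tau p = 1 / θ := by rw [hθ, theta0, one_div_div]
  have hf : expect p (fun A => f (y + (n / tau p * T) • (w A - z))) ≤
      f y + T * fderiv ℝ f y (u - z) + T ^ 2 / (2 * θ) * wnormSq v (u - z) := by
    -- The direction is the full prox displacement scaled by `T / θ`, so that its restriction to `A`
    -- is the actual move from `y` to the next iterate.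
    have he := h.eso y ((T / θ) • (u - z))
    have e1 : ∀ A, restrictTo A ((T / θ) • (u - z)) = (n / tau p * T) • (w A - z) := by
      intro A
      ext i
      simp only [restrictTo, Pi.smul_apply, Pi.sub_apply, smul_eq_mul]
      rw [show w A i = _ from zUpdate_eq _ _ _ _ A i, hθinv]
      split_ifs
      · rw [hu]; ring
      · ring
    have e2 : wnormSq v ((T / θ) • (u - z)) = (T / θ) ^ 2 * wnormSq v (u - z) := by
      simp only [wnormSq, Finset.mul_sum, Pi.smul_apply, smul_eq_mul]
      exact Finset.sum_congr rfl fun i _ => by ring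
    simp only [e1] at he
    rw [e2, map_smul, smul_eq_mul] at he
    change _ ≤ f y + θ * _ at he
    refine he.trans (le_of_eq ?_)
    field_simp
    ring
  have hsep : expect p (fun A => sepReal ψ (w A)) = θ * sepReal ψ u + (1 - θ) * sepReal ψ z := by
    rw [hθ]
    simp only [sepReal]
    rw [← expect_sum_ite h.uniform]
    congr 1; ext A
    refine Finset.sum_congr rfl fun i _ => ?_
    rw [show w A i = _ from zUpdate_eq _ _ _ _ A i]
    split_ifs <;> rfl
  have hnorm : expect p (fun A => wnormSq v (w A - xs)) =
      θ * wnormSq v (u - xs) + (1 - θ) * wnormSq v (z - xs) := by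
    rw [hθ]
    simp only [wnormSq]
    rw [← expect_sum_ite h.uniform]
    congr 1; ext A
    refine Finset.sum_congr rfl fun i _ => ?_
    rw [Pi.sub_apply, show w A i = _ from zUpdate_eq _ _ _ _ A i]
    split_ifs <;> rfl
  have hsplit : expect p (fun A => f (y + (n / tau p * T) • (w A - z)) +
        ((1 - T) * Φ + T * sepReal ψ z + T / θ * (sepReal ψ (w A) - sepReal ψ z)) -
          objReal f ψ xs + T ^ 2 / (2 * θ ^ 2) * wnormSq v (w A - xs)) =
      expect p (fun A => f (y + (n / tau p * T) • (w A - z))) +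
        (T / θ * expect p (fun A => sepReal ψ (w A)) +
        (T ^ 2 / (2 * θ ^ 2) * expect p (fun A => wnormSq v (w A - xs)) +
        ((1 - T) * Φ + T * sepReal ψ z - T / θ * sepReal ψ z - objReal f ψ xs))) := by
    rw [← expect_const_mul, ← expect_const_mul,
      ← expect_const (p := p) ((1 - T) * Φ + T * sepReal ψ z - T / θ * sepReal ψ z -
        objReal f ψ xs), ← expect_add, ← expect_add, ← expect_add]
    congr 1; ext A
    ring
  have hlin1 : fderiv ℝ f y (u - z) = fderiv ℝ f y (u - y) - fderiv ℝ f y (z - y) := by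
    rw [← map_sub]; congr 1; abel
  -- As `y` averages `x` and `z`, the gradient terms towards them cancel; only the term towards `xs`
  -- survives, and convexity of `f` bounds it.
  have hlin2 : (1 - T) * fderiv ℝ f y (x - y) + T * fderiv ℝ f y (z - y) = 0 := by
    rw [← smul_eq_mul, ← smul_eq_mul, ← map_smul, ← map_smul, ← map_add]
    have : (1 - T) • (x - y) + T • (z - y) = 0 := by
      simp only [y, yPoint]
      module
    rw [this, map_zero]
  have hgx := mul_le_mul_of_nonneg_left (add_fderiv_le h.differentiable h.convexOn x y)
    (by linarith : 0 ≤ 1 - T)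
  have hgs := mul_le_mul_of_nonneg_left (add_fderiv_le h.differentiable h.convexOn xs y) hT.le
  have hprox := mul_le_mul_of_nonneg_left (h.full_prox_le hT y z) hT.le
  change T * (fderiv ℝ f y (u - y) + T / (2 * θ) * wnormSq v (u - z) + sepReal ψ u +
    T / (2 * θ) * wnormSq v (u - xs)) ≤ T * (fderiv ℝ f y (xs - y) +
      T / (2 * θ) * wnormSq v (z - xs) + sepReal ψ xs) at hprox
  rw [hsplit, hsep, hnorm]
  rw [hlin1] at hf
  have e1 : T / θ * (θ * sepReal ψ u + (1 - θ) * sepReal ψ z) =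
      T * sepReal ψ u + T / θ * sepReal ψ z - T * sepReal ψ z := by field_simp; ring
  have e2 : T ^ 2 / (2 * θ ^ 2) * (θ * wnormSq v (u - xs) + (1 - θ) * wnormSq v (z - xs)) =
      T * (T / (2 * θ) * wnormSq v (u - xs)) + T ^ 2 / (2 * θ ^ 2) * wnormSq v (z - xs) -
      T * (T / (2 * θ) * wnormSq v (z - xs)) := by field_simp; ring
  have e3 : T ^ 2 / (2 * θ) * wnormSq v (u - z) = T * (T / (2 * θ) * wnormSq v (u - z)) := by
    ring
  rw [e1, e2]
  rw [e3] at hf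
  simp only [objReal]
  linarith

end IsProblem

end OneStep

/-! ### States with the history of `z` -/

/-- A state of the algorithm together with the points `z₀, …, z_age` of the current cycle. -/
structure AugState (n : ℕ) where
  toState : State n
  zhist : ℕ → Fin n → ℝ

/-- The augmented state at the beginning of a cycle. -/
def AugState.start {n : ℕ} (x : Fin n → ℝ) : AugState n := ⟨State.start x, fun _ => x⟩

section Aug

variable {n : ℕ} (f : (Fin n → ℝ) → ℝ) (ψ : Fin n → ℝ → EReal) (v : Fin n → ℝ)
  (p : PMF (Finset (Fin n))) (xs : Fin n → ℝ)

/-- An APPROX iteration without restart. -/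
def AugState.advance (A : Finset (Fin n)) (s : AugState n) : AugState n :=
  -- The value `0` for `σ` is a dummy: it is read only when a restart occurs.
  let s' := step f ψ v p 0 False A s.toState
  ⟨s', Function.update s.zhist (s.toState.age + 1) s'.z⟩

/-- The invariant kept along the runs of positive probability. -/
structure AugState.Valid (s : AugState n) : Prop where
  z_eq : s.toState.z = s.zhist s.toState.age
  hist_eq : ∀ j ≤ s.toState.age, s.toState.hist j = gammaSum (theta0 p) j s.zhist
  mem_dom : ∀ j ≤ s.toState.age, 1 ≤ j → s.zhist j ∈ dom ψ
  start_mem_dom : s.zhist 0 ∈ dom ψ ∨ theta0 p = 1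

/-- The Lyapunov function of APPROX at the `i`-th iterate of the current cycle. -/
def lyapunov (i : ℕ) (s : AugState n) : ℝ :=
  invThetaSqPred (theta0 p) i * (f (s.toState.hist i) +
    gammaSum (theta0 p) i (fun l => sepReal ψ (s.zhist l)) - objReal f ψ xs) +
    1 / (2 * theta0 p ^ 2) * wnormSq v (s.zhist i - xs)

/-- The real value of `Δ` on the domain of `F`. -/
def deltaReal (x : Fin n → ℝ) : ℝ :=
  (1 - theta0 p) / theta0 p ^ 2 * (objReal f ψ x - objReal f ψ xs) +
    1 / (2 * theta0 p ^ 2) * wnormSq v (x - xs)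

end Aug

/-! ### Lyapunov decrease and domain invariants within a cycle -/

section Pathwise

variable {n : ℕ} {f : (Fin n → ℝ) → ℝ} {ψ : Fin n → ℝ → EReal} {v : Fin n → ℝ}
  {p : PMF (Finset (Fin n))} {xs : Fin n → ℝ}

lemma gammaSum_congr {E : Type*} [AddCommGroup E] [Module ℝ E] {θ₀ : ℝ} {k : ℕ} {a b : ℕ → E}
    (hab : ∀ i ≤ k, a i = b i) : gammaSum θ₀ k a = gammaSum θ₀ k b :=
  Finset.sum_congr rfl fun i hi => by rw [hab i (by simpa [Nat.lt_succ_iff] using hi)]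

@[simp] lemma advance_age (A : Finset (Fin n)) (s : AugState n) :
    (s.advance f ψ v p A).toState.age = s.toState.age + 1 := by
  simp [AugState.advance, step]

lemma advance_hist_of_le {A : Finset (Fin n)} {s : AugState n} {i : ℕ}
    (hi : i ≤ s.toState.age) : (s.advance f ψ v p A).toState.hist i = s.toState.hist i := by
  simp [AugState.advance, step, Function.update_of_ne (show i ≠ s.toState.age + 1 by omega)]

lemma advance_zhist_of_le {A : Finset (Fin n)} {s : AugState n} {i : ℕ}
    (hi : i ≤ s.toState.age) : (s.advance f ψ v p A).zhist i = s.zhist i := by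
  simp [AugState.advance, Function.update_of_ne (show i ≠ s.toState.age + 1 by omega)]

lemma advance_zhist_succ {A : Finset (Fin n)} {s : AugState n} :
    (s.advance f ψ v p A).zhist (s.toState.age + 1) =
      zUpdate f ψ v (tau p) (theta (theta0 p) s.toState.age)
        (yPoint (theta (theta0 p) s.toState.age) s.toState.x s.toState.z) s.toState.z A := by
  simp [AugState.advance, step]

lemma advance_hist_succ {A : Finset (Fin n)} {s : AugState n} :
    (s.advance f ψ v p A).toState.hist (s.toState.age + 1) =
      yPoint (theta (theta0 p) s.toState.age) s.toState.x s.toState.z +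
        (n / tau p * theta (theta0 p) s.toState.age) •
          ((s.advance f ψ v p A).zhist (s.toState.age + 1) - s.toState.z) := by
  simp [AugState.advance, step]

/-- Earlier Lyapunov values depend only on frozen history, so all of them can be averaged at the end
of the cycle. -/
lemma lyapunov_advance_of_le {A : Finset (Fin n)} {s : AugState n} {i : ℕ}
    (hi : i ≤ s.toState.age) :
    lyapunov f ψ v p xs i (s.advance f ψ v p A) = lyapunov f ψ v p xs i s := by
  rw [lyapunov, lyapunov, advance_hist_of_le hi, advance_zhist_of_le hi]
  congr 4
  exact gammaSum_congr fun l hl => by rw [advance_zhist_of_le (hl.trans hi)]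

lemma valid_start {x : Fin n → ℝ} (hx : x ∈ dom ψ ∨ theta0 p = 1) :
    (AugState.start x).Valid ψ p where
  z_eq := rfl
  hist_eq j hj := by
    obtain rfl : j = 0 := by simpa [AugState.start, State.start] using hj
    simp [AugState.start, State.start]
  mem_dom j hj h1 := by
    obtain rfl : j = 0 := by simpa [AugState.start, State.start] using hj
    omega
  start_mem_dom := hx

namespace IsProblem

variable (h : IsProblem f ψ v p xs)
include h

lemma valid_advance {s : AugState n} (hs : s.Valid ψ p) {A : Finset (Fin n)} (hA : p A ≠ 0) :
    (s.advance f ψ v p A).Valid ψ p := by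
  have hθinv : (n : ℝ) / tau p = 1 / theta0 p := by rw [theta0, one_div_div]
  have hz : s.toState.z ∈ dom ψ ∨ theta0 p = 1 := by
    rw [hs.z_eq]
    rcases Nat.eq_zero_or_pos s.toState.age with h0 | h0
    · rw [h0]; exact hs.start_mem_dom
    · exact Or.inl (hs.mem_dom _ le_rfl h0)
  refine ⟨by simp [AugState.advance, step], fun j hj => ?_, fun j hj h1 => ?_, ?_⟩
  · rw [advance_age] at hj
    rcases Nat.le_succ_iff.1 hj with hj | rfl
    · rw [advance_hist_of_le hj, hs.hist_eq j hj]
      exact gammaSum_congr fun l hl => by rw [advance_zhist_of_le (hl.trans hj)]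
    · rw [Nat.succ_eq_add_one, advance_hist_succ, gammaSum_succ h.theta0_pos,
        advance_zhist_of_le le_rfl, ← hs.z_eq,
        gammaSum_congr fun l hl => advance_zhist_of_le hl, ← hs.hist_eq _ le_rfl, hθinv,
        yPoint, State.x]
      congr 2
      ring
  · rw [advance_age] at hj
    rcases Nat.le_succ_iff.1 hj with hj | rfl
    · rw [advance_zhist_of_le hj]; exact hs.mem_dom j hj h1
    · rw [Nat.succ_eq_add_one, advance_zhist_succ]
      exact h.zUpdate_mem_dom (theta_pos h.theta0_pos _) hz hA
  · rw [advance_zhist_of_le (Nat.zero_le _)]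
    exact hs.start_mem_dom

/-- The one-step inequality is divided by `T²`; then `(1 - θₖ)/θₖ² = 1/θ_{k-1}²` makes consecutive
coefficients match. -/
lemma expect_lyapunov_succ_le {s : AugState n} (hs : s.Valid ψ p) :
    expect p (fun A => lyapunov f ψ v p xs (s.toState.age + 1) (s.advance f ψ v p A)) ≤
      lyapunov f ψ v p xs s.toState.age s := by
  have hT := theta_pos h.theta0_pos s.toState.age
  have hT1 := (theta_le h.theta0_pos s.toState.age).trans (theta0_le_one (p := p))
  have key := h.expect_step_le hT hT1 s.toState.x s.toState.z
    (gammaSum (theta0 p) s.toState.age fun l => sepReal ψ (s.zhist l))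
  set T := theta (theta0 p) s.toState.age with hTdef
  have key2 := mul_le_mul_of_nonneg_left key (by positivity : 0 ≤ 1 / T ^ 2)
  have h0 := h.theta0_pos
  rw [← expect_const_mul] at key2
  refine (le_of_eq ?_).trans (key2.trans (le_of_eq ?_))
  · congr 1; ext A
    rw [lyapunov, advance_hist_succ, gammaSum_succ h0, advance_zhist_succ,
      gammaSum_congr (b := fun l => sepReal ψ (s.zhist l)) fun l hl => by
        rw [advance_zhist_of_le hl],
      advance_zhist_of_le le_rfl, ← hs.z_eq, invThetaSqPred, ← hTdef]
    simp only [smul_eq_mul]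
    field_simp
  · rw [lyapunov, ← hs.z_eq, ← one_sub_theta_div_sq h0, ← hTdef, State.x]
    field_simp

lemma expect_lyapunov_le {s : AugState n} (hs : s.Valid ψ p) (i : ℕ)
    (hi : i ≤ s.toState.age + 1) :
    expect p (fun A => lyapunov f ψ v p xs i (s.advance f ψ v p A)) ≤
      lyapunov f ψ v p xs (min i s.toState.age) s := by
  rcases Nat.le_succ_iff.1 hi with hi | rfl
  · simp [lyapunov_advance_of_le hi, min_eq_left hi]
  · simpa using h.expect_lyapunov_succ_le hs

/-! ### Bounds along a cycle -/

lemma hist_mem_dom {s : AugState n} (hs : s.Valid ψ p) {j : ℕ} (hj : j ≤ s.toState.age)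
    (h1 : 1 ≤ j) : s.toState.hist j ∈ dom ψ := by
  rw [hs.hist_eq j hj]
  refine convex_sum_mem_of_ne_zero (convexOn_sepReal h.closed).1 _ _ _
    (fun i hi => gammaCoeff_nonneg h.theta0_pos j i (Nat.lt_succ_iff.1 (Finset.mem_range.1 hi)))
    (sum_gammaCoeff h.theta0_pos j) fun i hi hne => hs.mem_dom i
      ((Nat.lt_succ_iff.1 (Finset.mem_range.1 hi)).trans hj) ?_
  rcases Nat.eq_zero_or_pos i with rfl | hi
  · obtain ⟨k, rfl⟩ : ∃ m, j = m + 1 := ⟨j - 1, by omega⟩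
    exact absurd (gammaCoeff_succ_zero k) hne
  · exact hi

/-- Jensen for the separable part: the combination of the values at the `z_l` dominates the value at
`x_i`. -/
lemma le_lyapunov {s : AugState n} (hs : s.Valid ψ p) {i : ℕ} (hi : i ≤ s.toState.age) :
    invThetaSqPred (theta0 p) i * (objReal f ψ (s.toState.hist i) - objReal f ψ xs) +
      1 / (2 * theta0 p ^ 2) * wnormSq v (s.zhist i - xs) ≤ lyapunov f ψ v p xs i s := by
  have hsep : sepReal ψ (s.toState.hist i) ≤
      gammaSum (theta0 p) i fun l => sepReal ψ (s.zhist l) := by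
    rw [hs.hist_eq i hi]
    rcases Nat.eq_zero_or_pos i with rfl | hpos
    · simp
    refine convexOn_sum_le (convexOn_sepReal h.closed) _ _ _
      (fun l hl => gammaCoeff_nonneg h.theta0_pos i l
        (Nat.lt_succ_iff.1 (Finset.mem_range.1 hl)))
      (sum_gammaCoeff h.theta0_pos i) fun l hl hne => hs.mem_dom l
        ((Nat.lt_succ_iff.1 (Finset.mem_range.1 hl)).trans hi) ?_
    rcases Nat.eq_zero_or_pos l with rfl | hl
    · obtain ⟨k, rfl⟩ : ∃ m, i = m + 1 := ⟨i - 1, by omega⟩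
      exact absurd (gammaCoeff_succ_zero k) hne
    · exact hl
  rw [lyapunov, objReal]
  have := invThetaSqPred_nonneg h.theta0_pos theta0_le_one i
  gcongr

lemma wnormSq_hist_le {s : AugState n} (hs : s.Valid ψ p) {j : ℕ} (hj : j ≤ s.toState.age) :
    wnormSq v (s.toState.hist j - xs) ≤
      gammaSum (theta0 p) j fun i => wnormSq v (s.zhist i - xs) := by
  rw [hs.hist_eq j hj]
  exact convexOn_sum_le (convexOn_wnormSq h.weight_pos xs) _ _ _
      (fun l hl => gammaCoeff_nonneg h.theta0_pos j l
        (Nat.lt_succ_iff.1 (Finset.mem_range.1 hl)))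
      (sum_gammaCoeff h.theta0_pos j) fun _ _ _ => Set.mem_univ _

/-- The gaps `F(xᵢ) - F(x*)` of the cycle are controlled by the Lyapunov values. -/
lemma sum_gap_le {s : AugState n} (hs : s.Valid ψ p) {j : ℕ} (hj : j ≤ s.toState.age) :
    ∑ i ∈ Finset.range (j + 1), gammaCoeff (theta0 p) j i * invThetaSqPred (theta0 p) i *
        (objReal f ψ (s.toState.hist i) - objReal f ψ xs) +
      1 / (2 * theta0 p ^ 2) * wnormSq v (s.toState.hist j - xs) ≤
      gammaSum (theta0 p) j fun i => lyapunov f ψ v p xs i s := by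
  have h1 : gammaSum (theta0 p) j (fun i =>
      invThetaSqPred (theta0 p) i * (objReal f ψ (s.toState.hist i) - objReal f ψ xs) +
      1 / (2 * theta0 p ^ 2) * wnormSq v (s.zhist i - xs)) ≤
      gammaSum (theta0 p) j fun i => lyapunov f ψ v p xs i s := by
    refine Finset.sum_le_sum fun i hi => ?_
    have hi := Nat.lt_succ_iff.1 (Finset.mem_range.1 hi)
    exact mul_le_mul_of_nonneg_left (h.le_lyapunov hs (hi.trans hj))
      (gammaCoeff_nonneg h.theta0_pos j i hi)
  refine le_trans ?_ h1
  have h2 := mul_le_mul_of_nonneg_left (h.wnormSq_hist_le hs hj)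
    (by positivity : 0 ≤ 1 / (2 * theta0 p ^ 2))
  simp only [gammaSum, smul_eq_mul, mul_add, Finset.sum_add_distrib] at h2 ⊢
  rw [Finset.mul_sum] at h2
  refine add_le_add (le_of_eq (Finset.sum_congr rfl fun i _ => by ring)) (h2.trans (le_of_eq ?_))
  exact Finset.sum_congr rfl fun i _ => by ring

/-- At `i = 0` the real-valued gap may be meaningless, since the start may be outside the domain,
but its weight vanishes. -/
lemma gap_term_nonneg {s : AugState n} (hs : s.Valid ψ p) {i j : ℕ} (hj : j ≤ s.toState.age)
    (h1 : 1 ≤ j) (hi : i ≤ j) : 0 ≤ gammaCoeff (theta0 p) j i * invThetaSqPred (theta0 p) i *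
        (objReal f ψ (s.toState.hist i) - objReal f ψ xs) := by
  rcases Nat.eq_zero_or_pos i with rfl | hpos
  · obtain ⟨k, rfl⟩ : ∃ m, j = m + 1 := ⟨j - 1, by omega⟩
    simp [gammaCoeff_succ_zero k]
  · exact mul_nonneg (gamma_mul_inv_nonneg h.theta0_pos theta0_le_one hi)
      (sub_nonneg.2 (h.objReal_le (h.hist_mem_dom hs (hi.trans hj) hpos)))

/-- The last gap's weight is split: the share `(1 - θ₀)/θ₀²` joins the distance term to form
`Δ(x_j)`, and `lastWeight` remains for the averaged point. -/
lemma sum_gap_add_deltaReal_le {s : AugState n} (hs : s.Valid ψ p) {j : ℕ}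
    (hj : j ≤ s.toState.age) (h1 : 1 ≤ j) :
    ∑ i ∈ Finset.range j, gammaCoeff (theta0 p) j i * invThetaSqPred (theta0 p) i *
        (objReal f ψ (s.toState.hist i) - objReal f ψ xs) +
      lastWeight (theta0 p) j * (objReal f ψ (s.toState.hist j) - objReal f ψ xs) +
      deltaReal f ψ v p xs (s.toState.hist j) ≤
      gammaSum (theta0 p) j fun i => lyapunov f ψ v p xs i s := by
  refine (le_of_eq ?_).trans (h.sum_gap_le hs hj)
  rw [Finset.sum_range_succ, gamma_mul_inv_self h.theta0_pos h1, deltaReal]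
  ring

lemma deltaReal_hist_le {s : AugState n} (hs : s.Valid ψ p) {j : ℕ}
    (hj : j ≤ s.toState.age) : deltaReal f ψ v p xs (s.toState.hist j) ≤
      gammaSum (theta0 p) j fun i => lyapunov f ψ v p xs i s := by
  rcases Nat.eq_zero_or_pos j with rfl | hpos
  · have := h.sum_gap_le hs hj
    simpa [gammaCoeff, invThetaSqPred, deltaReal] using this
  · refine le_trans ?_ (h.sum_gap_add_deltaReal_le hs hj hpos)
    refine le_add_of_nonneg_left (add_nonneg ?_ ?_)
    · exact Finset.sum_nonneg fun i hi =>
        h.gap_term_nonneg hs hj hpos (Finset.mem_range.1 hi).le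
    · exact mul_nonneg (lastWeight_pos h.theta0_pos j).le
        (sub_nonneg.2 (h.objReal_le (h.hist_mem_dom hs hj hpos)))

lemma convexOn_deltaReal : ConvexOn ℝ (dom ψ) (deltaReal f ψ v p xs) := by
  have h0 := h.theta0_pos
  have hc : 0 ≤ (1 - theta0 p) / theta0 p ^ 2 :=
    div_nonneg (by linarith [theta0_le_one (p := p)]) (by positivity)
  have h1 := (h.convexOn_objReal.add_const (-objReal f ψ xs)).smul hc
  have h2 := ((convexOn_wnormSq h.weight_pos xs).subset (Set.subset_univ _)
    h.convexOn_objReal.1).smul (by positivity : 0 ≤ 1 / (2 * theta0 p ^ 2))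
  exact h1.add h2

lemma deltaReal_nonneg {x : Fin n → ℝ} (hx : x ∈ dom ψ ∨ theta0 p = 1) :
    0 ≤ deltaReal f ψ v p xs x := by
  have h0 := h.theta0_pos
  have hw := wnormSq_nonneg h.weight_pos (x - xs)
  refine add_nonneg ?_ (by positivity)
  rcases hx with hx | hx
  · exact mul_nonneg (div_nonneg (by linarith [theta0_le_one (p := p)]) (by positivity))
      (sub_nonneg.2 (h.objReal_le hx))
  · simp [hx]

end IsProblem

/-! ### The averaged point and the restarting point -/

/-- The weights of the convex combination `x̊ⱼ`. -/
def ringWeight (θ₀ : ℝ) (j i : ℕ) : ℝ :=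
  (if i < j then gammaCoeff θ₀ j i * invThetaSqPred θ₀ i else lastWeight θ₀ j) /
    totalWeight θ₀ j

section RingWeight

variable {θ₀ : ℝ}

lemma sum_ringWeight_smul {E : Type*} [AddCommGroup E] [Module ℝ E] (j : ℕ) (a : ℕ → E) :
    ∑ i ∈ Finset.range (j + 1), ringWeight θ₀ j i • a i =
      (1 / totalWeight θ₀ j) •
        ((∑ i ∈ Finset.range j, (gammaCoeff θ₀ j i * invThetaSqPred θ₀ i) • a i) +
          lastWeight θ₀ j • a j) := by
  rw [Finset.sum_range_succ, smul_add, Finset.smul_sum]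
  congr 1
  · refine Finset.sum_congr rfl fun i hi => ?_
    rw [ringWeight, if_pos (Finset.mem_range.1 hi), smul_smul, div_eq_inv_mul, one_div]
  · rw [ringWeight, if_neg (lt_irrefl j), smul_smul, div_eq_inv_mul, one_div]

lemma ringWeight_nonneg (h0 : 0 < θ₀) (h1 : θ₀ ≤ 1) (j i : ℕ) : 0 ≤ ringWeight θ₀ j i := by
  refine div_nonneg ?_ (totalWeight_pos h0 h1 j).le
  split_ifs with hi
  · exact gamma_mul_inv_nonneg h0 h1 hi.le
  · exact (lastWeight_pos h0 j).le

lemma sum_ringWeight (h0 : 0 < θ₀) (h1 : θ₀ ≤ 1) (j : ℕ) :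
    ∑ i ∈ Finset.range (j + 1), ringWeight θ₀ j i = 1 := by
  have := sum_ringWeight_smul (θ₀ := θ₀) j fun _ => (1 : ℝ)
  simp only [smul_eq_mul, mul_one] at this
  rw [this, ← totalWeight, one_div, inv_mul_cancel₀ (totalWeight_pos h0 h1 j).ne']

lemma ringWeight_zero {j : ℕ} (hj : 1 ≤ j) : ringWeight θ₀ j 0 = 0 := by
  obtain ⟨k, rfl⟩ : ∃ m, j = m + 1 := ⟨j - 1, by omega⟩
  simp [ringWeight, gammaCoeff_succ_zero]

end RingWeight

lemma mCoeff_nonneg {θ₀ μ : ℝ} (h0 : 0 < θ₀) (h1 : θ₀ ≤ 1) (hμ : 0 ≤ μ) (j : ℕ) :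
    0 ≤ mCoeff θ₀ j μ :=
  mul_nonneg (div_nonneg (by positivity) (by nlinarith)) (totalWeight_pos h0 h1 j).le

namespace IsProblem

variable (h : IsProblem f ψ v p xs)
include h

lemma ringWeight_hist_mem {s : AugState n} (hs : s.Valid ψ p) (h1 : 1 ≤ s.toState.age) :
    ∀ i ∈ Finset.range (s.toState.age + 1), ringWeight (theta0 p) s.toState.age i ≠ 0 →
      s.toState.hist i ∈ dom ψ := by
  intro i hi hne
  refine h.hist_mem_dom hs (Nat.lt_succ_iff.1 (Finset.mem_range.1 hi)) ?_
  by_contra! hlt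
  obtain rfl : i = 0 := by omega
  exact hne (ringWeight_zero h1)

lemma xRing_mem_dom {s : AugState n} (hs : s.Valid ψ p) (h1 : 1 ≤ s.toState.age) :
    xRing (theta0 p) s.toState.age s.toState.hist ∈ dom ψ := by
  rw [xRing, ← sum_ringWeight_smul]
  exact convex_sum_mem_of_ne_zero h.convexOn_objReal.1 _ _ _
    (fun i _ => ringWeight_nonneg h.theta0_pos theta0_le_one _ _)
    (sum_ringWeight h.theta0_pos theta0_le_one _) (h.ringWeight_hist_mem hs h1)

lemma xBar_mem_dom {s : AugState n} (hs : s.Valid ψ p) (h1 : 1 ≤ s.toState.age) {σ : ℝ}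
    (hσ0 : 0 ≤ σ) (hσ1 : σ ≤ 1) : xBar (theta0 p) σ s.toState.age s.toState.hist ∈ dom ψ :=
  h.convexOn_objReal.1 (h.hist_mem_dom hs le_rfl h1) (h.xRing_mem_dom hs h1) hσ0
    (by linarith) (by ring)

lemma totalWeight_mul_gap_le {s : AugState n} (hs : s.Valid ψ p) (h1 : 1 ≤ s.toState.age) :
    totalWeight (theta0 p) s.toState.age *
        (objReal f ψ (xRing (theta0 p) s.toState.age s.toState.hist) - objReal f ψ xs) ≤
      ∑ i ∈ Finset.range s.toState.age,
        gammaCoeff (theta0 p) s.toState.age i * invThetaSqPred (theta0 p) i *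
        (objReal f ψ (s.toState.hist i) - objReal f ψ xs) +
      lastWeight (theta0 p) s.toState.age *
        (objReal f ψ (s.toState.hist s.toState.age) - objReal f ψ xs) := by
  have hW := totalWeight_pos h.theta0_pos theta0_le_one s.toState.age
  have hJ := convexOn_sum_le (h.convexOn_objReal.add_const (-objReal f ψ xs)) _ _ _
    (fun i _ => ringWeight_nonneg h.theta0_pos theta0_le_one s.toState.age i)
    (sum_ringWeight h.theta0_pos theta0_le_one _) (h.ringWeight_hist_mem hs h1)
  have e := sum_ringWeight_smul (θ₀ := theta0 p) s.toState.age fun i =>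
    objReal f ψ (s.toState.hist i) - objReal f ψ xs
  rw [sum_ringWeight_smul, ← xRing] at hJ
  simp only [smul_eq_mul, Pi.add_apply, ← sub_eq_add_neg] at hJ e
  rw [e] at hJ
  rw [one_div, inv_mul_eq_div, le_div_iff₀ hW] at hJ
  linarith

/-- This bound does not use growth of `F`; it pays for the part of `m` that `muF` cannot cover. -/
lemma deltaReal_xRing_le {s : AugState n} (hs : s.Valid ψ p) (h1 : 1 ≤ s.toState.age) :
    deltaReal f ψ v p xs (xRing (theta0 p) s.toState.age s.toState.hist) ≤
      ∑ i ∈ Finset.range (s.toState.age + 1), ringWeight (theta0 p) s.toState.age i *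
        gammaSum (theta0 p) i fun l => lyapunov f ψ v p xs l s := by
  rw [xRing, ← sum_ringWeight_smul]
  refine (convexOn_sum_le h.convexOn_deltaReal _ _ _
    (fun i _ => ringWeight_nonneg h.theta0_pos theta0_le_one _ _)
    (sum_ringWeight h.theta0_pos theta0_le_one _) (h.ringWeight_hist_mem hs h1)).trans ?_
  exact Finset.sum_le_sum fun i hi => mul_le_mul_of_nonneg_left
    (h.deltaReal_hist_le hs (Nat.lt_succ_iff.1 (Finset.mem_range.1 hi)))
    (ringWeight_nonneg h.theta0_pos theta0_le_one _ _)

variable {muF : ℝ} (hmuF : 0 < muF)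
  (hstrong : ∀ x, objective f ψ xs + ((muF / 2 * wnormSq v (x - xs) : ℝ) : EReal) ≤
    objective f ψ x)
include hmuF hstrong

/-- Growth bounds the distance part of `Δ` by the gap. The resulting constant is the inverse of the
factor in front of `totalWeight` in `mCoeff`. -/
lemma deltaReal_le_gap {x : Fin n → ℝ} (hx : x ∈ dom ψ) :
    deltaReal f ψ v p xs x ≤ (1 + muF * (1 - theta0 p)) / (muF * theta0 p ^ 2) *
      (objReal f ψ x - objReal f ψ xs) := by
  have hs := hstrong x
  rw [objective_eq h.closed hx, objective_eq h.closed h.min_mem_dom] at hs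
  have hs : objReal f ψ xs + muF / 2 * wnormSq v (x - xs) ≤ objReal f ψ x := by
    exact_mod_cast hs
  have h0 := h.theta0_pos
  have h2 := mul_le_mul_of_nonneg_left hs (by positivity : 0 ≤ 1 / (muF * theta0 p ^ 2))
  rw [deltaReal]
  have e1 : 1 / (2 * theta0 p ^ 2) * wnormSq v (x - xs) =
      1 / (muF * theta0 p ^ 2) * (muF / 2 * wnormSq v (x - xs)) := by field_simp
  have e2 : (1 + muF * (1 - theta0 p)) / (muF * theta0 p ^ 2) =
      (1 - theta0 p) / theta0 p ^ 2 + 1 / (muF * theta0 p ^ 2) := by field_simp; ring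
  rw [e1, e2]
  linarith

lemma mCoeff_mul_deltaReal_le {x : Fin n → ℝ} (hx : x ∈ dom ψ) (j : ℕ) :
    mCoeff (theta0 p) j muF * deltaReal f ψ v p xs x ≤
      totalWeight (theta0 p) j * (objReal f ψ x - objReal f ψ xs) := by
  have h0 := h.theta0_pos
  have h1 : 0 < 1 + muF * (1 - theta0 p) := by nlinarith [theta0_le_one (p := p)]
  refine (mul_le_mul_of_nonneg_left (h.deltaReal_le_gap hmuF hstrong hx)
    (mCoeff_nonneg h0 theta0_le_one hmuF.le j)).trans (le_of_eq ?_)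
  rw [mCoeff]
  field_simp

/-- The value of `Δ` at the restarting point is bounded by averages of Lyapunov values. -/
lemma deltaReal_xBar_le {s : AugState n} (hs : s.Valid ψ p) (h1 : 1 ≤ s.toState.age)
    {m ρ : ℝ} (hm : 0 ≤ m) (hρ1 : ρ ≤ 1)
    (hρm : ρ * m ≤ mCoeff (theta0 p) s.toState.age muF) :
    deltaReal f ψ v p xs (xBar (theta0 p) (1 / (1 + m)) s.toState.age s.toState.hist) ≤
      1 / (1 + m) * ((gammaSum (theta0 p) s.toState.age fun i => lyapunov f ψ v p xs i s) +
        (1 - ρ) * m * ∑ i ∈ Finset.range (s.toState.age + 1),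
          ringWeight (theta0 p) s.toState.age i *
            gammaSum (theta0 p) i fun l => lyapunov f ψ v p xs l s) := by
  have hring := h.xRing_mem_dom hs h1
  have hm1 : 0 < 1 + m := by linarith
  have hσ : 1 - 1 / (1 + m) = 1 / (1 + m) * m := by field_simp; ring
  have hconv := h.convexOn_deltaReal.2 (h.hist_mem_dom hs le_rfl h1) hring
    (by positivity : 0 ≤ 1 / (1 + m))
    (by rw [hσ]; positivity : 0 ≤ 1 - 1 / (1 + m)) (by ring)
  have hdel := h.deltaReal_nonneg (Or.inl hring)
  -- `a1` to `a4` give `Δ(x_j) + ρ m Δ(x̊)` at most the averaged Lyapunov values; `a5` covers the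
  -- remaining `(1 - ρ) m Δ(x̊)`.
  have a1 := h.mCoeff_mul_deltaReal_le hmuF hstrong hring s.toState.age
  have a2 := h.totalWeight_mul_gap_le hs h1
  have a3 := h.sum_gap_add_deltaReal_le hs le_rfl h1
  have a4 := mul_le_mul_of_nonneg_right hρm hdel
  have a5 := mul_le_mul_of_nonneg_left (h.deltaReal_xRing_le hs h1)
    (mul_nonneg (by linarith : 0 ≤ 1 - ρ) hm)
  rw [xBar]
  refine hconv.trans ?_
  rw [smul_eq_mul, smul_eq_mul, hσ, mul_assoc, ← mul_add]
  refine mul_le_mul_of_nonneg_left ?_ (by positivity)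
  linarith

end IsProblem

end Pathwise

/-! ### The restarted algorithm as a Markov chain -/

/-- The Markov operator `g ↦ (s ↦ E[g(T(Ŝ, s))])`. -/
def transition {n : ℕ} (p : PMF (Finset (Fin n))) {X : Type*} (T : Finset (Fin n) → X → X) :
    (X → ℝ) →ₗ[ℝ] (X → ℝ) where
  toFun g s := expect p fun A => g (T A s)
  map_add' g h := by ext s; exact expect_add _ _
  map_smul' c g := by ext s; exact expect_const_mul _ _

lemma transition_apply {n : ℕ} (p : PMF (Finset (Fin n))) {X : Type*} (T : Finset (Fin n) → X → X)
    (g : X → ℝ) (s : X) : transition p T g s = expect p fun A => g (T A s) := rfl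

section Chain

variable {n : ℕ} (f : (Fin n → ℝ) → ℝ) (ψ : Fin n → ℝ → EReal) (v : Fin n → ℝ)
  (p : PMF (Finset (Fin n))) (σ : ℝ) (K r : ℕ) (x₀ : Fin n → ℝ)

/-- The `k`-th pass through the loop, on augmented states. -/
def augStep (k : ℕ) (A : Finset (Fin n)) (s : AugState n) : AugState n :=
  if K ∣ k + r then
    AugState.start (xBar (theta0 p) σ (s.toState.age + 1) (s.advance f ψ v p A).toState.hist)
  else s.advance f ψ v p A

/-- The augmented state after `k` iterations. -/
def augRun (S : ℕ → Finset (Fin n)) : ℕ → AugState n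
  | 0 => AugState.start x₀
  | k + 1 => augStep f ψ v p σ K r k (S k) (augRun S k)

/-- The expectation of a function of the state after `k` iterations. -/
def runExpect : ℕ → (AugState n → ℝ) →ₗ[ℝ] ℝ
  | 0 => LinearMap.proj (AugState.start x₀)
  | k + 1 => runExpect k ∘ₗ transition p (augStep f ψ v p σ K r k)

/-- The expectation of an `[0, ∞]`-valued function of the state after `k` iterations. -/
def runLExpect : ℕ → (AugState n → ENNReal) → ENNReal
  | 0, g => g (AugState.start x₀)
  | k + 1, g => runLExpect k fun s => ∑ A, p A * g (augStep f ψ v p σ K r k A s)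

/-- The number of iterations since the last restart, after `k` iterations. -/
def ageAt : ℕ → ℕ
  | 0 => 0
  | k + 1 => if K ∣ k + r then 0 else ageAt k + 1

/-- The states that are reached with positive probability satisfy this predicate. -/
def Reachable (k : ℕ) (s : AugState n) : Prop :=
  s.Valid ψ p ∧ s.toState.age = ageAt K r k

end Chain

/-! ### Law of the augmented chain -/

section Law

variable {n : ℕ} {f : (Fin n → ℝ) → ℝ} {ψ : Fin n → ℝ → EReal} {v : Fin n → ℝ}
  {p : PMF (Finset (Fin n))} {σ : ℝ} {K r : ℕ} {x₀ : Fin n → ℝ}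

/-- Recording the `z` history is pure bookkeeping: the underlying algorithm is unchanged. -/
lemma augStep_toState (k : ℕ) (A : Finset (Fin n)) (s : AugState n) :
    (augStep f ψ v p σ K r k A s).toState = step f ψ v p σ (K ∣ k + r) A s.toState := by
  by_cases hk : K ∣ k + r
  · simp [augStep, step, AugState.advance, AugState.start, hk]
  · simp [augStep, step, AugState.advance, hk]

lemma augRun_toState (S : ℕ → Finset (Fin n)) (k : ℕ) :
    (augRun f ψ v p σ K r x₀ S k).toState = run f ψ v p σ K r x₀ S k := by
  induction k with
  | zero => rfl
  | succ k ih => rw [augRun, augStep_toState, ih]; rfl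

lemma augRun_congr {S S' : ℕ → Finset (Fin n)} {k : ℕ} (hS : ∀ j < k, S j = S' j) :
    augRun f ψ v p σ K r x₀ S k = augRun f ψ v p σ K r x₀ S' k := by
  induction k with
  | zero => rfl
  | succ k ih =>
    rw [augRun, augRun, ih fun j hj => hS j (hj.trans k.lt_succ_self), hS k k.lt_succ_self]

/-- The law of the state after `k` iterations. -/
lemma lintegral_augRun {Ω : Type*} [MeasurableSpace Ω] {P : Measure Ω}
    {S : ℕ → Ω → Finset (Fin n)} (hSm : ∀ k, Measurable (S k))
    (hSlaw : ∀ k, P.map (S k) = p.toMeasure) (hSindep : ProbabilityTheory.iIndepFun S P)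
    [IsProbabilityMeasure P] (k : ℕ) (g : AugState n → ENNReal) :
    ∫⁻ ω, g (augRun f ψ v p σ K r x₀ (fun j => S j ω) k) ∂P =
      runLExpect f ψ v p σ K r x₀ k g := by
  induction k generalizing g with
  | zero => simp [augRun, runLExpect]
  | succ k ih =>
    rw [runLExpect, ← ih]
    set X : Ω → (Finset.range k → Finset (Fin n)) := fun ω i => S i ω with hX
    have hXm : Measurable X := measurable_pi_lambda _ fun i => hSm i
    -- The state factors through the finitely many sets drawn so far (the default `∅` is never
    -- read). This space is finite and discrete, so no measurable structure on states is needed.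
    set R : (Finset.range k → Finset (Fin n)) → AugState n := fun a =>
      augRun f ψ v p σ K r x₀
        (fun j => if hj : j ∈ Finset.range k then a ⟨j, hj⟩ else ∅) k with hR
    have hRX : ∀ ω, augRun f ψ v p σ K r x₀ (fun j => S j ω) k = R (X ω) := fun ω =>
      augRun_congr fun j hj => by simp [hX, hj]
    have hind : ∀ A : Finset (Fin n), ProbabilityTheory.IndepFun
        (fun ω => if S k ω = A then (1 : ENNReal) else 0)
        (fun ω => g (augStep f ψ v p σ K r k A (R (X ω)))) P := fun A => by
      have := hSindep.indepFun_finset {k} (Finset.range k) (by simp) hSm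
      exact this.comp (φ := fun b => if b ⟨k, by simp⟩ = A then (1 : ENNReal) else 0)
        (ψ := fun a => g (augStep f ψ v p σ K r k A (R a)))
        Measurable.of_discrete Measurable.of_discrete
    have hm1 : ∀ A : Finset (Fin n),
        Measurable fun ω => if S k ω = A then (1 : ENNReal) else 0 := fun A =>
      (Measurable.of_discrete (f := fun B => if B = A then (1 : ENNReal) else 0)).comp (hSm k)
    have hm2 : ∀ A : Finset (Fin n),
        Measurable fun ω => g (augStep f ψ v p σ K r k A (R (X ω))) := fun A =>
      (Measurable.of_discrete (f := fun a => g (augStep f ψ v p σ K r k A (R a)))).comp hXm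
    have hprob : ∀ A, ∫⁻ ω, (if S k ω = A then (1 : ENNReal) else 0) ∂P = p A := fun A => by
      rw [← p.toMeasure_apply_singleton A (measurableSet_singleton A), ← hSlaw k,
        Measure.map_apply (hSm k) (measurableSet_singleton A),
        ← lintegral_indicator_one (hSm k (measurableSet_singleton A))]
      congr 1; ext ω
      simp [Set.indicator]
    calc ∫⁻ ω, g (augRun f ψ v p σ K r x₀ (fun j => S j ω) (k + 1)) ∂P
        = ∫⁻ ω, ∑ A, (if S k ω = A then (1 : ENNReal) else 0) *
            g (augStep f ψ v p σ K r k A (R (X ω))) ∂P := by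
          congr 1; ext ω
          simp [augRun, hRX]
      _ = ∑ A, p A * ∫⁻ ω, g (augStep f ψ v p σ K r k A (R (X ω))) ∂P := by
          rw [lintegral_finsetSum]
          swap
          · exact fun A _ => (hm1 A).mul (hm2 A)
          refine Finset.sum_congr rfl fun A _ => ?_
          rw [← hprob A]
          exact ProbabilityTheory.lintegral_mul_eq_lintegral_mul_lintegral_of_indepFun
            (hm1 A) (hm2 A) (hind A)
      _ = _ := by
          simp only [hRX]
          rw [lintegral_finsetSum _ fun A _ => (hm2 A).const_mul _]
          exact Finset.sum_congr rfl fun A _ => (lintegral_const_mul _ (hm2 A)).symm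

end Law

/-! ### Contraction in expectation over one cycle -/

section Rate

variable {n : ℕ} {f : (Fin n → ℝ) → ℝ} {ψ : Fin n → ℝ → EReal} {v : Fin n → ℝ}
  {p : PMF (Finset (Fin n))} {xs : Fin n → ℝ} {σ : ℝ} {K r : ℕ} {x₀ : Fin n → ℝ}

lemma map_gammaSum_le {θ₀ : ℝ} (h0 : 0 < θ₀) {E : Type*} [AddCommGroup E] [Module ℝ E]
    (ℓ : E →ₗ[ℝ] ℝ) {D : ℕ → E} {B : ℝ} {j : ℕ} (hB : ∀ i ≤ j, ℓ (D i) ≤ B) :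
    ℓ (gammaSum θ₀ j D) ≤ B := by
  rw [gammaSum, map_sum, ← one_mul B, ← sum_gammaCoeff h0 j, Finset.sum_mul]
  refine Finset.sum_le_sum fun i hi => ?_
  have hi := Nat.lt_succ_iff.1 (Finset.mem_range.1 hi)
  rw [map_smul, smul_eq_mul]
  exact mul_le_mul_of_nonneg_left (hB i hi) (gammaCoeff_nonneg h0 j i hi)

lemma gammaSum_apply {X : Type*} {θ₀ : ℝ} (j : ℕ) (D : ℕ → X → ℝ) (s : X) :
    gammaSum θ₀ j D s = gammaSum θ₀ j fun i => D i s := by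
  simp [gammaSum]

lemma ageAt_add {t j : ℕ} (ht : ageAt K r t = 0) (hno : ∀ i < j, ¬ K ∣ t + i + r) :
    ageAt K r (t + j) = j := by
  induction j with
  | zero => exact ht
  | succ j ih =>
    rw [← add_assoc, ageAt, if_neg (hno j j.lt_succ_self),
      ih fun i hi => hno i (hi.trans j.lt_succ_self)]

lemma runExpect_succ (k : ℕ) (g : AugState n → ℝ) :
    runExpect f ψ v p σ K r x₀ (k + 1) g =
      runExpect f ψ v p σ K r x₀ k (transition p (augStep f ψ v p σ K r k) g) := rfl

namespace IsProblem

variable (h : IsProblem f ψ v p xs)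
include h

lemma reachable_augStep (hσ0 : 0 ≤ σ) (hσ1 : σ ≤ 1) {k : ℕ} {s : AugState n}
    (hs : Reachable ψ p K r k s) {A : Finset (Fin n)} (hA : p A ≠ 0) :
    Reachable ψ p K r (k + 1) (augStep f ψ v p σ K r k A s) := by
  have hadv := h.valid_advance hs.1 hA
  rw [Reachable, augStep, ageAt]
  split_ifs with hk
  · refine ⟨valid_start (Or.inl ?_), rfl⟩
    have := h.xBar_mem_dom hadv (by simp) hσ0 hσ1
    rwa [advance_age] at this
  · exact ⟨hadv, by rw [advance_age, hs.2]⟩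

variable (hσ0 : 0 ≤ σ) (hσ1 : σ ≤ 1) (hx₀ : x₀ ∈ dom ψ ∨ theta0 p = 1)
include hσ0 hσ1 hx₀

lemma runExpect_mono {k : ℕ} {g g' : AugState n → ℝ}
    (hg : ∀ s, Reachable ψ p K r k s → g s ≤ g' s) :
    runExpect f ψ v p σ K r x₀ k g ≤ runExpect f ψ v p σ K r x₀ k g' := by
  induction k generalizing g g' with
  | zero => exact hg _ ⟨valid_start hx₀, rfl⟩
  | succ k ih =>
    exact ih fun s hs => expect_mono fun A hA => hg _ (h.reachable_augStep hσ0 hσ1 hs hA)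

/-- Passage from real expectations, where linearity is available, to `[0, ∞]`. Nonnegativity on
reachable states is what lets `ENNReal.ofReal` commute with the sums. -/
lemma runLExpect_le {k : ℕ} {G : AugState n → ENNReal} {g : AugState n → ℝ}
    (hg : ∀ s, Reachable ψ p K r k s → 0 ≤ g s)
    (hG : ∀ s, Reachable ψ p K r k s → G s ≤ ENNReal.ofReal (g s)) :
    runLExpect f ψ v p σ K r x₀ k G ≤
      ENNReal.ofReal (runExpect f ψ v p σ K r x₀ k g) := by
  induction k generalizing G g with
  | zero => exact hG _ ⟨valid_start hx₀, rfl⟩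
  | succ k ih =>
    have hterm : ∀ s, Reachable ψ p K r k s → ∀ A,
        0 ≤ (p A).toReal * g (augStep f ψ v p σ K r k A s) := fun s hs A => by
      by_cases hA : p A = 0
      · simp [hA]
      · exact mul_nonneg ENNReal.toReal_nonneg (hg _ (h.reachable_augStep hσ0 hσ1 hs hA))
    rw [runExpect_succ]
    refine ih (fun s hs => ?_) fun s hs => ?_ <;> rw [transition_apply, expect]
    · exact Finset.sum_nonneg fun A _ => hterm s hs A
    rw [ENNReal.ofReal_sum_of_nonneg fun A _ => hterm s hs A]
    refine Finset.sum_le_sum fun A _ => ?_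
    by_cases hA : p A = 0
    · simp [hA]
    · rw [ENNReal.ofReal_mul ENNReal.toReal_nonneg, ENNReal.ofReal_toReal (p.apply_ne_top A)]
      gcongr
      exact hG _ (h.reachable_augStep hσ0 hσ1 hs hA)

/-- Iterating the one-step decrease back to the cycle start, where `L_0` is `Δ` itself. At each step
back, `min i j` keeps frozen values and lowers the newest index by one. -/
lemma runExpect_lyapunov_le {t j : ℕ} (ht : ageAt K r t = 0)
    (hno : ∀ i < j, ¬ K ∣ t + i + r) {i : ℕ} (hi : i ≤ j) :
    runExpect f ψ v p σ K r x₀ (t + j) (lyapunov f ψ v p xs i) ≤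
      runExpect f ψ v p σ K r x₀ t fun s => deltaReal f ψ v p xs s.toState.x := by
  induction j generalizing i with
  | zero =>
    obtain rfl : i = 0 := by omega
    refine h.runExpect_mono hσ0 hσ1 hx₀ fun s hs => le_of_eq ?_
    rw [lyapunov, deltaReal, State.x, hs.2.trans ht, hs.1.hist_eq 0 (Nat.zero_le _)]
    simp [invThetaSqPred, objReal]
  | succ j ih =>
    have hno' : ∀ i < j, ¬ K ∣ t + i + r := fun i hi => hno i (hi.trans j.lt_succ_self)
    refine le_trans ?_ (ih hno' (min_le_right i j))
    rw [← add_assoc, runExpect_succ]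
    refine h.runExpect_mono hσ0 hσ1 hx₀ fun s hs => ?_
    have hage : s.toState.age = j := hs.2.trans (ageAt_add ht hno')
    have := h.expect_lyapunov_le hs.1 i (by omega)
    rw [hage] at this
    simpa only [transition_apply, augStep, if_neg (hno j j.lt_succ_self)] using this

lemma runExpect_deltaReal_le {t j : ℕ} (ht : ageAt K r t = 0)
    (hno : ∀ i < j, ¬ K ∣ t + i + r) :
    runExpect f ψ v p σ K r x₀ (t + j) (fun s => deltaReal f ψ v p xs s.toState.x) ≤
      runExpect f ψ v p σ K r x₀ t fun s => deltaReal f ψ v p xs s.toState.x := by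
  refine le_trans ?_ (map_gammaSum_le h.theta0_pos _ fun i hi =>
    h.runExpect_lyapunov_le hσ0 hσ1 hx₀ ht hno hi)
  refine h.runExpect_mono hσ0 hσ1 hx₀ fun s hs => ?_
  rw [gammaSum_apply, ← hs.2.trans (ageAt_add ht hno)]
  exact h.deltaReal_hist_le hs.1 le_rfl

end IsProblem

/-- The contraction of `Δ` over one cycle, including the restart at its end. -/
lemma IsProblem.runExpect_restart_le (h : IsProblem f ψ v p xs)
    (hx₀ : x₀ ∈ dom ψ ∨ theta0 p = 1) {muF : ℝ} (hmuF : 0 < muF)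
    (hstrong : ∀ x, objective f ψ xs + ((muF / 2 * wnormSq v (x - xs) : ℝ) : EReal) ≤
      objective f ψ x)
    {m ρ : ℝ} (hm : 0 ≤ m) (hρ1 : ρ ≤ 1) (hσ : σ = 1 / (1 + m)) {t j : ℕ}
    (ht : ageAt K r t = 0) (hno : ∀ i < j, ¬ K ∣ t + i + r) (hres : K ∣ t + j + r)
    (hρm : ρ * m ≤ mCoeff (theta0 p) (j + 1) muF) :
    runExpect f ψ v p σ K r x₀ (t + j + 1) (fun s => deltaReal f ψ v p xs s.toState.x) ≤
      (1 - ρ * (m / (1 + m))) *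
        runExpect f ψ v p σ K r x₀ t fun s => deltaReal f ψ v p xs s.toState.x := by
  have hm1 : 0 < 1 + m := by linarith
  have hσ0 : 0 ≤ σ := by rw [hσ]; positivity
  have hσ1 : σ ≤ 1 := by rw [hσ, div_le_one hm1]; linarith
  set B := runExpect f ψ v p σ K r x₀ t fun s => deltaReal f ψ v p xs s.toState.x
  -- The last iteration is taken without its restart: the restarting point is a function of the
  -- completed cycle, which the restart erases.
  set ℓ : (AugState n → ℝ) →ₗ[ℝ] ℝ := runExpect f ψ v p σ K r x₀ (t + j) ∘ₗ
    transition p (AugState.advance f ψ v p) with hℓ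
  set D : ℕ → AugState n → ℝ := lyapunov f ψ v p xs with hD
  have hℓD : ∀ i ≤ j + 1, ℓ (D i) ≤ B := fun i hi => by
    refine le_trans ?_ (h.runExpect_lyapunov_le hσ0 hσ1 hx₀ ht hno (min_le_right i j))
    refine h.runExpect_mono hσ0 hσ1 hx₀ fun s hs => ?_
    have hage : s.toState.age = j := hs.2.trans (ageAt_add ht hno)
    have := h.expect_lyapunov_le hs.1 i (by omega)
    rwa [hage] at this
  have hℓγ : ∀ a ≤ j + 1, ℓ (gammaSum (theta0 p) a D) ≤ B := fun a ha =>
    map_gammaSum_le h.theta0_pos ℓ fun i hi => hℓD i (hi.trans ha)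
  set H : AugState n → ℝ := (1 / (1 + m)) • (gammaSum (theta0 p) (j + 1) D +
    ((1 - ρ) * m) • ∑ a ∈ Finset.range (j + 1 + 1), ringWeight (theta0 p) (j + 1) a •
      gammaSum (theta0 p) a D) with hH
  have h1 : runExpect f ψ v p σ K r x₀ (t + j + 1)
      (fun s => deltaReal f ψ v p xs s.toState.x) ≤ ℓ H := by
    rw [runExpect_succ]
    refine h.runExpect_mono hσ0 hσ1 hx₀ fun s hs => ?_
    rw [transition_apply, transition_apply]
    refine expect_mono fun A hA => ?_
    have hage : s.toState.age = j := hs.2.trans (ageAt_add ht hno)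
    have := h.deltaReal_xBar_le hmuF hstrong (h.valid_advance hs.1 hA) (by simp) hm hρ1
      (by rwa [advance_age, hage])
    rw [advance_age, hage, ← hσ] at this
    rw [augStep, if_pos hres, hage]
    refine this.trans (le_of_eq ?_)
    simp only [hH, hD, Pi.smul_apply, Pi.add_apply, Finset.sum_apply, gammaSum_apply,
      smul_eq_mul, hσ]
  refine h1.trans ?_
  rw [hH, map_smul, map_add, map_smul, map_sum]
  simp only [map_smul, smul_eq_mul]
  have h2 : ∑ a ∈ Finset.range (j + 1 + 1), ringWeight (theta0 p) (j + 1) a *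
      ℓ (gammaSum (theta0 p) a D) ≤ B := by
    rw [← one_mul B, ← sum_ringWeight h.theta0_pos theta0_le_one (j + 1), Finset.sum_mul]
    exact Finset.sum_le_sum fun a ha => mul_le_mul_of_nonneg_left
      (hℓγ a (Nat.lt_succ_iff.1 (Finset.mem_range.1 ha)))
      (ringWeight_nonneg h.theta0_pos theta0_le_one _ _)
  have h3 := mul_le_mul_of_nonneg_left h2 (mul_nonneg (by linarith : 0 ≤ 1 - ρ) hm)
  have e : (1 - ρ * (m / (1 + m))) * B = 1 / (1 + m) * (B + (1 - ρ) * m * B) := by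
    field_simp
    ring
  rw [e]
  exact mul_le_mul_of_nonneg_left (add_le_add (hℓγ _ le_rfl) h3) (by positivity)

end Rate

/-! ### The rate of the restarted algorithm -/

section FinalRate

variable {n : ℕ} {f : (Fin n → ℝ) → ℝ} {ψ : Fin n → ℝ → EReal} {v : Fin n → ℝ}
  {p : PMF (Finset (Fin n))} {xs : Fin n → ℝ} {σ : ℝ} {K r : ℕ} {x₀ : Fin n → ℝ}

lemma IsProblem.Delta_eq (h : IsProblem f ψ v p xs) {x : Fin n → ℝ}
    (hx : x ∈ dom ψ ∨ theta0 p = 1) :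
    Delta f ψ v (theta0 p) xs x = ENNReal.ofReal (deltaReal f ψ v p xs x) := by
  have h0 := h.theta0_pos
  have hw : 0 ≤ 1 / (2 * theta0 p ^ 2) * wnormSq v (x - xs) :=
    mul_nonneg (by positivity) (wnormSq_nonneg h.weight_pos _)
  by_cases h1 : theta0 p = 1
  · simp [Delta, deltaReal, h1]
  · have hx := hx.resolve_right h1
    have hc : 0 ≤ (1 - theta0 p) / theta0 p ^ 2 :=
      div_nonneg (by linarith [theta0_le_one (p := p)]) (by positivity)
    have hgap := sub_nonneg.2 (h.objReal_le hx)
    rw [Delta, deltaReal, ENNReal.ofReal_add (mul_nonneg hc hgap) hw, ENNReal.ofReal_mul hc,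
      objective_eq h.closed hx, objective_eq h.closed h.min_mem_dom, ← EReal.coe_sub,
      EReal.toENNReal_of_ne_top (EReal.coe_ne_top _), EReal.toReal_coe]

lemma IsProblem.Delta_eq_top (h : IsProblem f ψ v p xs) {x : Fin n → ℝ} (hx : x ∉ dom ψ)
    (h1 : theta0 p ≠ 1) : Delta f ψ v (theta0 p) xs x = ⊤ := by
  have h0 := h.theta0_pos
  have hc : 0 < (1 - theta0 p) / theta0 p ^ 2 :=
    div_pos (sub_pos.2 (lt_of_le_of_ne theta0_le_one h1)) (by positivity)
  rw [Delta, objective_eq_top h.closed hx, objective_eq h.closed h.min_mem_dom,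
    EReal.top_sub_coe, EReal.toENNReal_top, ENNReal.mul_top (by simpa using hc), top_add]

lemma Reachable.x_mem_dom (h : IsProblem f ψ v p xs) {k : ℕ} {s : AugState n}
    (hs : Reachable ψ p K r k s) : s.toState.x ∈ dom ψ ∨ theta0 p = 1 := by
  rw [State.x]
  rcases Nat.eq_zero_or_pos s.toState.age with h0 | h0
  · rw [h0, hs.1.hist_eq 0 (Nat.zero_le _), gammaSum_zero]
    exact hs.1.start_mem_dom
  · exact Or.inl (h.hist_mem_dom hs.1 le_rfl h0)

/-- Iteration `k` produces state `k + 1`, so the test `K ∣ k + r` starts cycles at the states `c K +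
(1 - r)`. -/
lemma ageAt_restart (hr : r = 0 ∨ r = 1) (c : ℕ) : ageAt K r (c * K + (1 - r)) = 0 := by
  obtain h0 | ⟨t, ht⟩ : c * K + (1 - r) = 0 ∨ ∃ t, c * K + (1 - r) = t + 1 := by
    rcases Nat.eq_zero_or_pos (c * K + (1 - r)) with h | h
    · exact Or.inl h
    · exact Or.inr ⟨_, (Nat.sub_add_cancel h).symm⟩
  · rw [h0, ageAt]
  · rw [ht, ageAt, if_pos]
    have : t + r = c * K := by omega
    rw [this]
    exact Nat.dvd_mul_left K c

lemma not_dvd_cycle (hr : r = 0 ∨ r = 1) (c : ℕ) {i : ℕ} (hi : i < K - 1) :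
    ¬ K ∣ c * K + (1 - r) + i + r := by
  have e : c * K + (1 - r) + i + r = c * K + (i + 1) := by omega
  rw [e, Nat.dvd_add_right (Nat.dvd_mul_left K c)]
  exact Nat.not_dvd_of_pos_of_lt (Nat.succ_pos i) (by omega)

/-- Geometric decrease of `E[Δ]` along the restarts. -/
lemma IsProblem.runExpect_deltaReal_geometric (h : IsProblem f ψ v p xs)
    (hx₀ : x₀ ∈ dom ψ ∨ theta0 p = 1) {muF : ℝ} (hmuF : 0 < muF)
    (hstrong : ∀ x, objective f ψ xs + ((muF / 2 * wnormSq v (x - xs) : ℝ) : EReal) ≤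
      objective f ψ x) (hr : r = 0 ∨ r = 1) (hK : 1 ≤ K)
    {m ρ : ℝ} (hm : 0 ≤ m) (hρ1 : ρ ≤ 1) (hσ : σ = 1 / (1 + m))
    (hρm : ρ * m ≤ mCoeff (theta0 p) K muF) {k : ℕ} (hk : 1 ≤ k) :
    runExpect f ψ v p σ K r x₀ k (fun s => deltaReal f ψ v p xs s.toState.x) ≤
      (1 - ρ * (m / (1 + m))) ^ ((k - (1 - r)) / K) * deltaReal f ψ v p xs x₀ := by
  have hm1 : 0 < 1 + m := by linarith
  have hσ0 : 0 ≤ σ := by rw [hσ]; positivity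
  have hσ1 : σ ≤ 1 := by rw [hσ, div_le_one hm1]; linarith
  have hR : 0 ≤ 1 - ρ * (m / (1 + m)) := by
    have : m / (1 + m) ≤ 1 := (div_le_one hm1).2 (by linarith)
    have : ρ * (m / (1 + m)) ≤ 1 := mul_le_one₀ hρ1 (by positivity) this
    linarith
  have hstart : runExpect f ψ v p σ K r x₀ (1 - r)
      (fun s => deltaReal f ψ v p xs s.toState.x) ≤ deltaReal f ψ v p xs x₀ := by
    rcases hr with rfl | rfl
    -- For `r = 0` there is a restart after the very first iteration. That cycle of length one does
    -- not match the `m` computed for `K`; with `ρ = 0` it is used only as non-increase.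
    · have := h.runExpect_restart_le (K := K) (r := 0) (t := 0) (j := 0) (ρ := 0) hx₀ hmuF
        hstrong hm zero_le_one hσ rfl (by simp) (by simp)
        (by simpa using mCoeff_nonneg h.theta0_pos theta0_le_one hmuF.le 1)
      simp only [zero_mul, sub_zero, one_mul] at this
      exact this
    · exact le_rfl
  have hcycle : ∀ c, runExpect f ψ v p σ K r x₀ (c * K + (1 - r))
      (fun s => deltaReal f ψ v p xs s.toState.x) ≤
        (1 - ρ * (m / (1 + m))) ^ c * deltaReal f ψ v p xs x₀ := by
    intro c
    induction c with
    | zero => simpa using hstart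
    | succ c ih =>
      have hres : K ∣ c * K + (1 - r) + (K - 1) + r := by
        have : c * K + (1 - r) + (K - 1) + r = (c + 1) * K := by
          rw [add_mul]; omega
        rw [this]
        exact Nat.dvd_mul_left K _
      have := h.runExpect_restart_le (t := c * K + (1 - r)) (j := K - 1) hx₀ hmuF hstrong hm
        hρ1 hσ (ageAt_restart hr c) (fun i hi => not_dvd_cycle hr c hi) hres
        (by rwa [Nat.sub_add_cancel hK])
      have e : c * K + (1 - r) + (K - 1) + 1 = (c + 1) * K + (1 - r) := by
        rw [add_mul]; omega
      rw [e] at this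
      refine this.trans ((mul_le_mul_of_nonneg_left ih hR).trans (le_of_eq ?_))
      ring
  set c := (k - (1 - r)) / K with hc
  have hkc : k = c * K + (1 - r) + (k - (1 - r)) % K := by
    have := Nat.div_add_mod' (k - (1 - r)) K
    rw [← hc] at this
    omega
  have hlt := Nat.mod_lt (k - (1 - r)) (show K > 0 by omega)
  refine le_trans ?_ (hcycle c)
  conv_lhs => rw [hkc]
  exact h.runExpect_deltaReal_le hσ0 hσ1 hx₀ (ageAt_restart hr c) fun i hi =>
    not_dvd_cycle hr c (by omega)

/-- The contraction factor of a cycle of length `K ≥ (2√3 √(λ/μ) - 2) / θ₀`. -/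
lemma le_mCoeff_div {θ₀ μ lam : ℝ} (h0 : 0 < θ₀) (h1 : θ₀ ≤ 1) (hμ : 0 < μ) (hlam : 0 ≤ lam)
    (hK : 1 ≤ K) (hlo : 2 * √3 / θ₀ * √(lam / μ) - 2 / θ₀ ≤ K) :
    (lam - μ * (1 - θ₀)) / (lam + 1) ≤ mCoeff θ₀ K μ / (1 + mCoeff θ₀ K μ) := by
  have hS := sq_div_twelve_le_gammaSum h0 h1 hK
  rw [gammaSum_invThetaSqPred h0 hK] at hS
  have hsq : (2 * √3 / θ₀ * √(lam / μ)) ^ 2 ≤ (K + 2 / θ₀) ^ 2 := by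
    gcongr
    linarith
  have e1 : (2 * √3 / θ₀ * √(lam / μ)) ^ 2 = 12 * (lam / μ) / θ₀ ^ 2 := by
    rw [mul_pow, div_pow, mul_pow, Real.sq_sqrt (by norm_num), Real.sq_sqrt (by positivity)]
    ring
  rw [e1] at hsq
  have hu : 0 < 1 + μ * (1 - θ₀) := by nlinarith
  have hW : lam - μ * (1 - θ₀) ≤ μ * θ₀ ^ 2 * totalWeight θ₀ K := by
    have h2 : lam / μ / θ₀ ^ 2 ≤ totalWeight θ₀ K + (1 - θ₀) / θ₀ ^ 2 := by
      have : 12 * (lam / μ) / θ₀ ^ 2 = 12 * (lam / μ / θ₀ ^ 2) := by ring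
      linarith
    have h3 := mul_le_mul_of_nonneg_left h2 (by positivity : 0 ≤ μ * θ₀ ^ 2)
    have e2 : μ * θ₀ ^ 2 * (lam / μ / θ₀ ^ 2) = lam := by field_simp
    have e3 : μ * θ₀ ^ 2 * (totalWeight θ₀ K + (1 - θ₀) / θ₀ ^ 2) =
        μ * θ₀ ^ 2 * totalWeight θ₀ K + μ * (1 - θ₀) := by field_simp
    rw [e2, e3] at h3
    linarith
  set w := μ * θ₀ ^ 2 * totalWeight θ₀ K with hw
  have hw0 : 0 ≤ w := by
    have := totalWeight_pos h0 h1 K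
    positivity
  have em : mCoeff θ₀ K μ = w / (1 + μ * (1 - θ₀)) := by rw [mCoeff, hw]; ring
  have e4 : w / (1 + μ * (1 - θ₀)) / (1 + w / (1 + μ * (1 - θ₀))) =
      w / (1 + μ * (1 - θ₀) + w) := by field_simp
  -- The ratio `w / (1 + μ(1 - θ₀) + w)` increases with `w`; at the lower bound `w = lam - μ(1 -
  -- θ₀)` its denominator is `lam + 1`.
  rw [em, e4, div_le_div_iff₀ (by linarith) (by linarith)]
  nlinarith

/-- As a function of `μ`, the coefficient is increasing, concave and zero at `0`, so shrinking `μ`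
by a factor shrinks it by no more than that factor. -/
lemma min_mul_mCoeff_le {θ₀ μ muF : ℝ} (h0 : 0 < θ₀) (h1 : θ₀ ≤ 1) (hμ : 0 < μ)
    (hmuF : 0 < muF) (j : ℕ) :
    min (muF / μ) 1 * mCoeff θ₀ j μ ≤ mCoeff θ₀ j muF := by
  have hW := totalWeight_pos h0 h1 j
  have hu : 0 < 1 + μ * (1 - θ₀) := by nlinarith
  have huF : 0 < 1 + muF * (1 - θ₀) := by nlinarith
  rw [mCoeff, mCoeff, ← mul_assoc]
  refine mul_le_mul_of_nonneg_right ?_ hW.le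
  rw [← mul_div_assoc, div_le_div_iff₀ hu huF]
  have h2 : min (muF / μ) 1 * μ ≤ muF := by
    have := mul_le_mul_of_nonneg_right (min_le_left (muF / μ) 1) hμ.le
    rwa [div_mul_cancel₀ _ hμ.ne'] at this
  have h3 : min (muF / μ) 1 ≤ 1 := min_le_right _ _
  have h4 : min (muF / μ) 1 * μ * (1 + muF * (1 - θ₀)) ≤ muF * (1 + μ * (1 - θ₀)) := by
    nlinarith [mul_nonneg (mul_nonneg hμ.le hmuF.le) (sub_nonneg.2 h1)]
  nlinarith [pow_pos h0 2]

/-- The convergence rate for every cycle length `K` between `(2√3 √(λ/μ) - 2) / θ₀` and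
`2√3 √(λ/μ) / θ₀`. -/
theorem IsProblem.expectedDelta_le (h : IsProblem f ψ v p xs) {muF : ℝ} (hmuF : 0 < muF)
    (hstrong : ∀ x, objective f ψ xs + ((muF / 2 * wnormSq v (x - xs) : ℝ) : EReal) ≤
      objective f ψ x)
    {Ω : Type*} [MeasurableSpace Ω] {P : Measure Ω} [IsProbabilityMeasure P]
    {S : ℕ → Ω → Finset (Fin n)} (hSm : ∀ k, Measurable (S k))
    (hSlaw : ∀ k, P.map (S k) = p.toMeasure) (hSindep : ProbabilityTheory.iIndepFun S P)
    (hr : r = 0 ∨ r = 1) {μ lam : ℝ} (hμ : 0 < μ) (hlam : μ ≤ lam)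
    (hlo : 2 * √3 / theta0 p * √(lam / μ) - 2 / theta0 p ≤ K)
    (hhi : (K : ℝ) ≤ 2 * √3 / theta0 p * √(lam / μ))
    (hσ : σ = 1 / (1 + mCoeff (theta0 p) K μ)) {k : ℕ} (hk : K ≤ k) :
    expectedDelta P f ψ v p S xs σ K r x₀ k ≤
      ENNReal.ofReal ((1 - min (muF / μ) 1 *
        ((lam - μ * (1 - theta0 p)) / (lam + 1))) ^
          ((k : ℝ) * theta0 p * √μ / (2 * √3 * √lam) - 1)) *
        Delta f ψ v (theta0 p) xs x₀ := by
  have h0 := h.theta0_pos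
  have h1 := theta0_le_one (p := p)
  set θ₀ := theta0 p with hθ₀
  have hlam0 : 0 < lam := hμ.trans_le hlam
  have hK : 1 ≤ K := by
    have h3 : 1 < √3 := by rw [Real.lt_sqrt] <;> norm_num
    have h4 : 1 ≤ √(lam / μ) := by rw [Real.one_le_sqrt, one_le_div hμ]; exact hlam
    have h5 : 2 / θ₀ < 2 * √3 / θ₀ * √(lam / μ) := by
      rw [div_mul_eq_mul_div]
      gcongr
      nlinarith
    have : (0 : ℝ) < K := by linarith
    exact_mod_cast this
  set m := mCoeff θ₀ K μ with hm
  have hm0 : 0 ≤ m := mCoeff_nonneg h0 h1 hμ.le K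
  set ρ := min (muF / μ) 1 with hρ
  have hρ0 : 0 < ρ := lt_min (by positivity) one_pos
  have hρ1 : ρ ≤ 1 := min_le_right _ _
  set a := (lam - μ * (1 - θ₀)) / (lam + 1) with ha
  have ham : a ≤ m / (1 + m) := le_mCoeff_div h0 h1 hμ hlam0.le hK hlo
  have ha0 : 0 ≤ a := div_nonneg (by nlinarith) (by linarith)
  have hm1 : m / (1 + m) < 1 := (div_lt_one (by linarith)).2 (by linarith)
  have hR : 0 ≤ 1 - ρ * (m / (1 + m)) := by nlinarith
  have hRq : 1 - ρ * (m / (1 + m)) ≤ 1 - ρ * a := by nlinarith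
  have hq0 : 0 < 1 - ρ * a := by nlinarith
  have hq1 : 1 - ρ * a ≤ 1 := by nlinarith
  set e := (k : ℝ) * θ₀ * √μ / (2 * √3 * √lam) - 1 with he
  -- Otherwise `Δ(x₀) = ∞`, and the right side is infinite because the base `1 - ρ a` is strictly
  -- positive.
  by_cases hx₀ : x₀ ∈ dom ψ ∨ θ₀ = 1
  swap
  · push Not at hx₀
    rw [h.Delta_eq_top hx₀.1 hx₀.2, ENNReal.mul_top]
    · exact le_top
    · simpa using Real.rpow_pos_of_pos hq0 e
  have hpow : (1 - ρ * (m / (1 + m))) ^ ((k - (1 - r)) / K) ≤ (1 - ρ * a) ^ e := by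
    refine (pow_le_pow_left₀ hR hRq _).trans ?_
    rw [← Real.rpow_natCast]
    refine Real.rpow_le_rpow_of_exponent_ge hq0 hq1 ?_
    have hKpos : (0 : ℝ) < K := by exact_mod_cast hK
    have e1 : e = k / (2 * √3 / θ₀ * √(lam / μ)) - 1 := by
      rw [he, Real.sqrt_div hlam0.le]
      field_simp
    have e2 : (k : ℝ) / (2 * √3 / θ₀ * √(lam / μ)) ≤ k / K := by gcongr
    -- The shift `1 - r` costs nothing: the remainder modulo `K` is at most `K - 1`, leaving room
    -- for one unit.
    have e3 : (k : ℝ) ≤ (((k - (1 - r)) / K : ℕ) + 1 : ℝ) * K := by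
      have h5 := Nat.div_add_mod' (k - (1 - r)) K
      have h6 := Nat.mod_lt (k - (1 - r)) (show K > 0 by omega)
      have h7 : k ≤ ((k - (1 - r)) / K + 1) * K := by rw [add_mul]; omega
      exact_mod_cast h7
    have e4 : (k : ℝ) / K ≤ ((k - (1 - r)) / K : ℕ) + 1 := by
      rwa [div_le_iff₀ hKpos]
    rw [e1]
    linarith
  have hσ0 : 0 ≤ σ := by rw [hσ]; positivity
  have hσ1 : σ ≤ 1 := by rw [hσ, div_le_one (by linarith)]; linarith
  have hgeo := h.runExpect_deltaReal_geometric (σ := σ) hx₀ hmuF hstrong hr hK hm0 hρ1 hσ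
    (min_mul_mCoeff_le h0 h1 hμ hmuF K) (hK.trans hk)
  have hlaw := lintegral_augRun (f := f) (ψ := ψ) (v := v) (σ := σ) (K := K) (r := r)
    (x₀ := x₀) hSm hSlaw hSindep k fun s => Delta f ψ v θ₀ xs s.toState.x
  simp only [augRun_toState] at hlaw
  rw [expectedDelta, hlaw, h.Delta_eq hx₀, ← ENNReal.ofReal_mul (Real.rpow_nonneg hq0.le e)]
  refine (h.runLExpect_le hσ0 hσ1 hx₀
    (fun s hs => h.deltaReal_nonneg (xs := xs) (hs.x_mem_dom h))
    fun s hs => (h.Delta_eq (hs.x_mem_dom h)).le).trans ?_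
  refine ENNReal.ofReal_le_ofReal (hgeo.trans ?_)
  exact mul_le_mul_of_nonneg_right hpow (h.deltaReal_nonneg hx₀)

end FinalRate

end ApproxRestart

end

/-- It remains to check that both ceilings lie in the window for `K` required by
`IsProblem.expectedDelta_le`. The window has width `2/θ₀ ≥ 2`, enough for rounding up and for the
extra `1` in (b). -/
theorem mainTheorem4 {n : ℕ}
    (f : (Fin n → ℝ) → ℝ) (ψ : Fin n → ℝ → EReal) (v : Fin n → ℝ)
    (p : PMF (Finset (Fin n)))
    (hfd : Differentiable ℝ f) (hfc : ConvexOn ℝ Set.univ f)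
    (hψ : ∀ i, ApproxRestart.IsClosedProperConvex (ψ i))
    (hv : ∀ i, 0 < v i)
    (hunif : ApproxRestart.IsUniform p) (hτ : 0 < ApproxRestart.tau p)
    (heso : ApproxRestart.ESO f p v)
    (xs : Fin n → ℝ)
    (hxs : ∀ x, ApproxRestart.objective f ψ xs ≤ ApproxRestart.objective f ψ x)
    (muF : ℝ) (hmuF : 0 < muF)
    (hstrong : ∀ x, ApproxRestart.objective f ψ xs +
        ((muF / 2 * ApproxRestart.wnormSq v (x - xs) : ℝ) : EReal) ≤
      ApproxRestart.objective f ψ x)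
    {Ω : Type*} [MeasurableSpace Ω] (P : MeasureTheory.Measure Ω)
    [MeasureTheory.IsProbabilityMeasure P]
    (S : ℕ → Ω → Finset (Fin n)) (hSm : ∀ k, Measurable (S k))
    (hSlaw : ∀ k, P.map (S k) = p.toMeasure)
    (hSindep : ProbabilityTheory.iIndepFun S P)
    (x₀ : Fin n → ℝ) (r : ℕ) (hr : r = 0 ∨ r = 1)
    (θ₀ : ℝ) (hθ₀ : θ₀ = ApproxRestart.theta0 p) :
    (∀ μ : ℝ, 0 < μ → ∀ lam : ℝ, μ ≤ lam → ∀ K : ℕ,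
      K = ⌈2 * √3 / θ₀ * √(lam / μ) - 2 / θ₀⌉₊ → ∀ σ : ℝ,
      σ = 1 / (1 + ApproxRestart.mCoeff θ₀ K μ) → ∀ k : ℕ, K ≤ k →
        ApproxRestart.expectedDelta P f ψ v p S xs σ K r x₀ k ≤
          ENNReal.ofReal
            ((1 - min (muF / μ) 1 * ((lam - μ * (1 - θ₀)) / (lam + 1))) ^
              ((k : ℝ) * θ₀ * √μ / (2 * √3 * √lam) - 1)) *
            ApproxRestart.Delta f ψ v θ₀ xs x₀) ∧
    (∀ μ : ℝ, 0 < μ → μ ≤ 1 → ∀ K : ℕ,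
      K = ⌈2 * √3 / θ₀ * √(1 + 1 / μ) - 2 / θ₀ + 1⌉₊ → ∀ σ : ℝ,
      σ = 1 / (1 + ApproxRestart.mCoeff θ₀ K μ) → ∀ k : ℕ, K ≤ k →
        ApproxRestart.expectedDelta P f ψ v p S xs σ K r x₀ k ≤
          ENNReal.ofReal
            ((1 - min (muF / μ) 1 * ((1 + μ * θ₀) / (2 + μ))) ^
              ((k : ℝ) * θ₀ * √μ / (2 * √3 * √(1 + μ)) - 1)) *
            ApproxRestart.Delta f ψ v θ₀ xs x₀) := by
  have h : ApproxRestart.IsProblem f ψ v p xs :=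
    ⟨hfd, hfc, hψ, hv, hunif, hτ, heso, hxs⟩
  subst hθ₀
  have h0 := h.theta0_pos
  have h1 := ApproxRestart.theta0_le_one (p := p)
  have h3 : 1 < √3 := by rw [Real.lt_sqrt] <;> norm_num
  have hlarge : ∀ t : ℝ, 1 ≤ t → 2 / ApproxRestart.theta0 p ≤
      2 * √3 / ApproxRestart.theta0 p * √t := fun t ht => by
    rw [div_mul_eq_mul_div]
    gcongr
    nlinarith [Real.one_le_sqrt.2 ht]
  have h2 : 2 ≤ 2 / ApproxRestart.theta0 p := by
    rw [le_div_iff₀ h0]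
    linarith
  constructor
  · intro μ hμ lam hlam K hK σ hσ k hk
    have hl := hlarge (lam / μ) ((one_le_div hμ).2 hlam)
    have hceil := Nat.ceil_lt_add_one (sub_nonneg.2 hl)
    refine h.expectedDelta_le hmuF hstrong hSm hSlaw hSindep hr hμ hlam ?_ ?_ hσ hk
    · rw [hK]; exact Nat.le_ceil _
    · rw [hK]; linarith
  · intro μ hμ _ K hK σ hσ k hk
    -- This is `lam / μ` for `lam = 1 + μ`.
    have e : 1 + 1 / μ = (1 + μ) / μ := by field_simp; ring
    rw [e] at hK
    have hl := hlarge ((1 + μ) / μ) ((one_le_div hμ).2 (by linarith))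
    have hceil := Nat.ceil_lt_add_one (by linarith : 0 ≤ 2 * √3 / ApproxRestart.theta0 p *
      √((1 + μ) / μ) - 2 / ApproxRestart.theta0 p + 1)
    have hle := Nat.le_ceil (2 * √3 / ApproxRestart.theta0 p *
      √((1 + μ) / μ) - 2 / ApproxRestart.theta0 p + 1)
    have := h.expectedDelta_le (x₀ := x₀) hmuF hstrong hSm hSlaw hSindep hr hμ
      (by linarith : μ ≤ 1 + μ) (by rw [hK]; linarith) (by rw [hK]; linarith) hσ hk
    have e2 : (1 + μ - μ * (1 - ApproxRestart.theta0 p)) / (1 + μ + 1) =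
        (1 + μ * ApproxRestart.theta0 p) / (2 + μ) := by
      congr 1 <;> ring
    rwa [e2] at this
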